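/- Let $V$ be an oriented real vector space of dimension $r$ with orientation $o$, and let $\Delta\subset V\setminus\{0\}$ be a finite set which spans $V$ and satisfies $-\Delta=\Delta$. Let $V^*$ be the dual space, $S(V)$ the ring of polynomial functions on $V^*$, $\hat S(V)$ the ring of formal power series, $R_\Delta=\Delta^{-1}S(V)$ and $\hat R_\Delta=\Delta^{-1}\hat S(V)$ the rings obtained by inverting the linear functions $\alpha\in\Delta$, graded by degree; $S(V^*)$ is the ring of polynomial functions on $V$. Let $G_\Delta\subset R_\Delta$ be the span of the $1/\prod_{\alpha\in\kappa}\alpha^{n_\alpha}$ with $\kappa\subset\Delta$ generating $V$ and $n_\alpha\ge 1$, and $NG_\Delta$ the span of the $\psi/\prod_{\alpha\in\kappa}\alpha^{n_\alpha}$ with $\psi\in S(V)$, $\kappa\subset\Delta$ not generating $V$ and $n_\alpha\ge 0$. Let $\mathcal B(\Delta)$ be the set of subsets $\sigma\subset\Delta$ that are bases of $V$, and $\phi_\sigma=1/\prod_{\alpha\in\sigma}\alpha$ for $\sigma\in\mathcal B(\Delta)$. Let $\mathrm{Princ}_\Delta:\hat R_\Delta\to G_\Delta$ be the Taylor projection $\hat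 R_\Delta\to\bigoplus_{j\le -r}R_\Delta[j]$ followed by the projection of $R_\Delta$ onto $G_\Delta$ along $NG_\Delta$, and let $\mathrm{Res}_\Delta$ be $\mathrm{Princ}_\Delta$ followed by the projection of $G_\Delta$ onto its homogeneous part of degree $-r$, which is the span of the $\phi_\sigma$. A wall of $V$ is a hyperplane generated by $r-1$ linearly independent elements of $\Delta$; $V_{reg}$ is the complement of the walls, and a chamber of $V$ is a connected component of $V_{reg}$. Let $\delta$ be a connected component of $\{y\in V^*:\langle y,\alpha\rangle\ne0\ \forall\alpha\in\Delta\}$ and $\delta^\vee=\{h\in V:\langle y,h\rangle\ge 0\ \forall y\in\delta\}$. For a set $\sigma\subset V$, let $C(\sigma)$ be the closed convex cone generated by $\sigma$ and $[C(\sigma)]$ its characteristic function. Let $\mathcal P_\Delta(\delta)$ be the space of functions on $V_{reg}$ spanned by the $P\,[C(\sigma)]$ with $P\in S(V^*)$, $\sigma\in\mathcal B(\Delta)$ and $C(\sigma)\subset\delta^\vee$. For $f\in\mathcal P_\Delta(\delta)$, $g\in G_\Delta$ and $dy\in\wedge^rV$, we write $L^o_\delta f=g\otimes dy$ if for all $y\in\delta$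 and $dh\in\wedge^rV^*$ the integral $\int_{V,o}e^{-\langle y,h\rangle}f(h)\,dh$ converges absolutely and equals $g(y)\langle dy,dh\rangle$. Then $R_\Delta=G_\Delta\oplus NG_\Delta$, and for all $g\in G_\Delta$ and $dy\in\wedge^rV$ there is exactly one $f\in\mathcal P_\Delta(\delta)$ with $L^o_\delta f=g\otimes dy$; so for $\phi\in\hat R_\Delta$ the inverse Laplace transform $F^o_\delta(\phi\otimes dy):=(L^o_\delta)^{-1}(\mathrm{Princ}_\Delta(\phi)\otimes dy)\in\mathcal P_\Delta(\delta)$ is well defined. Moreover: 1. (Jeffrey-Kirwan) For all $\phi\in\hat R_\Delta$, $dy\in\wedge^rV$ and $h\in V_{reg}$, with $e^h$ the power series of $y\mapsto e^{\langle y,h\rangle}$, $$F^o_\delta(\phi\otimes dy)(h)=F^o_\delta\bigl(\mathrm{Res}_\Delta(e^h\phi)\otimes dy\bigr)(h).$$ 2. For $\sigma\in\mathcal B(\Delta)$, let $\sigma^\delta$ be the set obtained from $\sigma$ by replacing each $\alpha\in\sigma$ which is not positive on $\delta$ by $-\alpha$, and let $\epsilon(\sigma,\delta)=(-1)^k$,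 where $k$ is the number of elements replaced. Then $\sigma^\delta\in\mathcal B(\Delta)$, $C(\sigma^\delta)\subset\delta^\vee$ and $\phi_\sigma=\epsilon(\sigma,\delta)\phi_{\sigma^\delta}$. 3. For every $\phi\in\hat R_\Delta$ there are polynomial functions $c_\sigma$ on $V$ $(\sigma\in\mathcal B(\Delta))$ with $\mathrm{Res}_\Delta(e^h\phi)=\sum_{\sigma}c_\sigma(h)\phi_\sigma$ for all $h\in V$. 4. Let $\phi\in\hat R_\Delta$, let $dy\in\wedge^rV$, and let $dh\in\wedge^rV^*$ be positive for $o$ with $\langle dy,dh\rangle=1$. Let $\gamma$ be a chamber of $V$ and $h\in\gamma$. If $\mathrm{Res}_\Delta(e^h\phi)=\sum_{\sigma\in\mathcal B(\Delta)}c_\sigma\phi_\sigma$ with real numbers $c_\sigma$, then $$F^o_\delta(\phi\otimes dy)(h)=\sum_{\sigma\in\mathcal B(\Delta),\ \gamma\subset C(\sigma^\delta)}\epsilon(\sigma,\delta)\,c_\sigma\operatorname{vol}(\sigma,dh)^{-1},$$ where $\operatorname{vol}(\sigma,dh)$ is the volume, for the measure defined by $dh$, of the parallelepiped constructed on $\sigma$.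 -/

import Mathlib

open MeasureTheory

namespace JeffreyKirwan

noncomputable section

/-! ### Rational functions and formal Laurent-type series with poles on hyperplanes

`V` is a real vector space with a basis `b`, indexed by `Fin r`.  The ring `S(V)` of polynomial
functions on the dual space of `V` is `MvPolynomial (Fin r) ℝ`, the variable `X i` being the linear
function `y ↦ y (b i)`; its completion is `MvPowerSeries (Fin r) ℝ`. -/

section Algebra

variable {V : Type*} [AddCommGroup V] [Module ℝ V] {r : ℕ} (b : Module.Basis (Fin r) ℝ V)
  (Δ : Finset V)

/-- The vector `α` of `V`, as a linear function on the dual space. -/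
def lin (α : V) : MvPolynomial (Fin r) ℝ :=
  ∑ i, MvPolynomial.C (b.repr α i) * MvPolynomial.X i

/-- The multiplicative set generated by the linear functions `α ∈ Δ`, in `S(V)`. -/
def denoms : Submonoid (MvPolynomial (Fin r) ℝ) :=
  Submonoid.closure (lin b '' (Δ : Set V))

/-- The multiplicative set generated by the linear functions `α ∈ Δ`, among power series. -/
def denomsHat : Submonoid (MvPowerSeries (Fin r) ℝ) :=
  (denoms b Δ).map (MvPolynomial.coeToMvPowerSeries.ringHom (σ := Fin r) (R := ℝ))

/-- `R_Δ`: the ring of rational functions generated by `S(V)` and the inverses of the `α ∈ Δ`. -/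
abbrev R : Type := Localization (denoms b Δ)

/-- `R̂_Δ`: the ring generated by the power series and the inverses of the `α ∈ Δ`. -/
abbrev RHat : Type := Localization (denomsHat b Δ)

/-- The canonical map from `R_Δ` to `R̂_Δ`. -/
def toHat : R b Δ →+* RHat b Δ :=
  IsLocalization.map (T := denomsHat b Δ) (RHat b Δ)
    (MvPolynomial.coeToMvPowerSeries.ringHom (σ := Fin r) (R := ℝ))
    (Submonoid.le_comap_map (denoms b Δ))

/-- The product of the `α ^ n α` over `α ∈ Δ`. -/
def den (n : Δ → ℕ) : denoms b Δ :=
  ⟨∏ α : Δ, lin b (α : V) ^ n α, Submonoid.prod_mem _ fun α _ =>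
    Submonoid.pow_mem _ (Submonoid.subset_closure
      (Set.mem_image_of_mem (lin b) (Finset.mem_coe.mpr α.2))) _⟩

/-- The power series of the polynomial `∏ α ^ n α`. -/
def denHat (n : Δ → ℕ) : denomsHat b Δ :=
  ⟨((den b Δ n : MvPolynomial (Fin r) ℝ) : MvPowerSeries (Fin r) ℝ),
    Submonoid.mem_map_of_mem MvPolynomial.coeToMvPowerSeries.ringHom (den b Δ n).2⟩

theorem exists_den {p : MvPolynomial (Fin r) ℝ} (hp : p ∈ denoms b Δ) :
    ∃ n : Δ → ℕ, (den b Δ n : MvPolynomial (Fin r) ℝ) = p := by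
  classical
  induction hp using Submonoid.closure_induction with
  | mem x hx =>
    obtain ⟨α, hα, rfl⟩ := hx
    refine ⟨Pi.single (⟨α, hα⟩ : Δ) 1, ?_⟩
    simp only [den]
    rw [Finset.prod_eq_single (⟨α, hα⟩ : Δ)]
    · simp
    · intro β _ hβ
      simp [Pi.single_eq_of_ne hβ]
    · simp
  | one => exact ⟨0, by simp [den]⟩
  | mul x y _ _ hx hy =>
    obtain ⟨n, hn⟩ := hx
    obtain ⟨m, hm⟩ := hy
    exact ⟨n + m, by rw [← hn, ← hm]; simp [den, pow_add, Finset.prod_mul_distrib]⟩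

/-- Every element of `R̂_Δ` is a quotient `f / ∏ α ^ n α`. -/
theorem exists_rep (φ : RHat b Δ) :
    ∃ p : (Δ → ℕ) × MvPowerSeries (Fin r) ℝ, φ = Localization.mk p.2 (denHat b Δ p.1) := by
  induction φ using Localization.induction_on with
  | H y =>
    obtain ⟨f, s⟩ := y
    obtain ⟨p, hp, hs⟩ := s.2
    obtain ⟨n, hn⟩ := exists_den b Δ hp
    refine ⟨⟨n, f⟩, ?_⟩
    have : s = denHat b Δ n := Subtype.ext (by rw [← hs]; simp [denHat, hn])
    rw [this]

/-- The Taylor expansion at order `K`: if `φ = f / ∏ α ^ n α` with a power series `f`, and if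
`m = ∑ n α`, then one keeps the part of `f` of degree at most `K + m`.
The result does not depend on the representation of `φ`: see `taylor_mk`. -/
def taylor (K : ℤ) (φ : RHat b Δ) : R b Δ :=
  Localization.mk
    (MvPowerSeries.truncTotal (K + ∑ α, ((exists_rep b Δ φ).choose.1 α : ℤ) + 1).toNat
      (exists_rep b Δ φ).choose.2)
    (den b Δ (exists_rep b Δ φ).choose.1)

/-- The projection onto the homogeneous part of degree `j`. -/
def gradedPart (j : ℤ) (φ : RHat b Δ) : R b Δ :=
  taylor b Δ j φ - taylor b Δ (j - 1) φ

/-- `G_Δ`: the span of the `1 / ∏_{α ∈ κ} α ^ n α` with `κ ⊆ Δ` generating `V` and all `n α`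
positive; here `κ` is the set where `n` does not vanish. -/
def G : Submodule ℝ (R b Δ) :=
  Submodule.span ℝ {φ | ∃ n : Δ → ℕ, Submodule.span ℝ {v : V | ∃ α : Δ, n α ≠ 0 ∧ (α : V) = v} = ⊤ ∧
    φ = Localization.mk 1 (den b Δ n)}

/-- `NG_Δ`: the span of the `ψ / ∏_{α ∈ κ} α ^ n α` with `ψ ∈ S(V)` and `κ ⊆ Δ` not generating. -/
def NG : Submodule ℝ (R b Δ) :=
  Submodule.span ℝ {φ | ∃ (n : Δ → ℕ) (ψ : MvPolynomial (Fin r) ℝ),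
    Submodule.span ℝ {v : V | ∃ α : Δ, n α ≠ 0 ∧ (α : V) = v} ≠ ⊤ ∧
    φ = Localization.mk ψ (den b Δ n)}

open Classical in
/-- The bases of `V` contained in `Δ`. -/
def bases : Finset (Finset V) :=
  Δ.powerset.filter fun σ =>
    LinearIndepOn ℝ id (σ : Set V) ∧ Submodule.span ℝ (σ : Set V) = ⊤

open Classical in
/-- `φ_σ = 1 / ∏_{α ∈ σ} α`, for `σ ⊆ Δ`. -/
def phi (σ : Finset V) : R b Δ :=
  Localization.mk 1 (den b Δ fun α => if (α : V) ∈ σ then 1 else 0)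

open Classical in
/-- `Princ_Δ`: the Taylor expansion at order `-r`, followed by the projection of `R_Δ` onto `G_Δ`
along `NG_Δ` (these subspaces are complementary when `Δ` consists of nonzero vectors). -/
def princ (φ : RHat b Δ) : R b Δ :=
  if hc : IsCompl (G b Δ) (NG b Δ) then (G b Δ).projection (NG b Δ) hc (taylor b Δ (-(r : ℤ)) φ)
  else 0

/-- The Jeffrey-Kirwan residue: `Princ_Δ`, followed by the projection of `G_Δ` onto its part of
degree `-r`, which is the span of the `φ_σ`. -/
def res (φ : RHat b Δ) : R b Δ :=
  gradedPart b Δ (-(r : ℤ)) (toHat b Δ (princ b Δ φ))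

/-- The power series of the function `y ↦ exp ⟨y, h⟩`. -/
def expSeries (h : V) : MvPowerSeries (Fin r) ℝ :=
  fun n => ∏ i, b.repr h i ^ n i / (n i).factorial

/-- `e^h`, as an element of `R̂_Δ`. -/
def expHat (h : V) : RHat b Δ := algebraMap _ _ (expSeries b h)

/-! Independence of the Taylor expansion from the representation. -/

theorem lin_isHomogeneous (α : V) : (lin b α).IsHomogeneous 1 :=
  MvPolynomial.IsHomogeneous.sum _ _ _ fun i _ => by
    simpa using (MvPolynomial.isHomogeneous_C (Fin r) (b.repr α i)).mul
      (MvPolynomial.isHomogeneous_X ℝ i)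

theorem den_isHomogeneous (n : Δ → ℕ) :
    (den b Δ n : MvPolynomial (Fin r) ℝ).IsHomogeneous (∑ α, n α) :=
  MvPolynomial.IsHomogeneous.prod _ _ _ fun α _ => by
    simpa using (lin_isHomogeneous b (α : V)).pow (n α)

theorem lin_ne_zero {α : V} (hα : α ≠ 0) : lin b α ≠ 0 := by
  intro h0
  apply hα
  apply b.repr.injective
  ext i
  have := congrArg (MvPolynomial.coeff (Finsupp.single i 1)) h0
  simpa [lin, MvPolynomial.coeff_sum, MvPolynomial.coeff_C_mul, MvPolynomial.coeff_X,
    Finsupp.single_left_inj] using this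

theorem truncTotal_mul {q : MvPolynomial (Fin r) ℝ} {m : ℕ} (hq : q.IsHomogeneous m) (k : ℤ)
    (f : MvPowerSeries (Fin r) ℝ) :
    MvPowerSeries.truncTotal (k + m).toNat ((q : MvPowerSeries (Fin r) ℝ) * f) =
      q * MvPowerSeries.truncTotal k.toNat f := by
  classical
  ext d
  have key : ∀ p ∈ Finset.HasAntidiagonal.antidiagonal d,
      (if Finsupp.degree d < (k + m).toNat then
        MvPolynomial.coeff p.1 q * MvPowerSeries.coeff p.2 f else 0) =
      MvPolynomial.coeff p.1 q *
        MvPolynomial.coeff p.2 (MvPowerSeries.truncTotal k.toNat f) := by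
    intro p hp
    rw [MvPowerSeries.coeff_truncTotal_eq_ite]
    by_cases hc : MvPolynomial.coeff p.1 q = 0
    · simp [hc]
    · have h1 : Finsupp.degree p.1 = m := by
        by_contra hne
        exact hc (hq.coeff_eq_zero hne)
      have h2 : Finsupp.degree d = m + Finsupp.degree p.2 := by
        rw [← Finset.HasAntidiagonal.mem_antidiagonal.mp hp, map_add, h1]
      have h3 : Finsupp.degree d < (k + m).toNat ↔ Finsupp.degree p.2 < k.toNat := by omega
      simp [h3]
  rw [MvPowerSeries.coeff_truncTotal_eq_ite, MvPolynomial.coeff_mul, MvPowerSeries.coeff_mul,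
    ← Finset.sum_congr rfl key]
  split_ifs <;> simp

theorem taylor_mk (h0 : (0 : V) ∉ Δ) (K : ℤ) (n : Δ → ℕ) (f : MvPowerSeries (Fin r) ℝ) :
    taylor b Δ K (Localization.mk f (denHat b Δ n)) =
      Localization.mk (MvPowerSeries.truncTotal (K + ∑ α, (n α : ℤ) + 1).toNat f)
        (den b Δ n) := by
  have hrep := (exists_rep b Δ (Localization.mk f (denHat b Δ n))).choose_spec
  unfold taylor
  set p := (exists_rep b Δ (Localization.mk f (denHat b Δ n))).choose
  rw [Localization.mk_eq_mk_iff, Localization.r_iff_exists] at hrep ⊢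
  obtain ⟨⟨_, c, hc, rfl⟩, hrep⟩ := hrep
  refine ⟨1, ?_⟩
  have hc0 : c ≠ 0 := by
    obtain ⟨m, rfl⟩ := exists_den b Δ hc
    exact Finset.prod_ne_zero_iff.mpr fun α _ =>
      pow_ne_zero _ (lin_ne_zero b fun h => h0 (h ▸ α.2))
  have hc1 : (MvPolynomial.coeToMvPowerSeries.ringHom c : MvPowerSeries (Fin r) ℝ) ≠ 0 := by
    simpa using hc0
  have h1 := mul_left_cancel₀ hc1 hrep
  have h2 := truncTotal_mul (den_isHomogeneous b Δ p.1) (K + ∑ α, (n α : ℤ) + 1) f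
  have h3 := truncTotal_mul (den_isHomogeneous b Δ n) (K + ∑ α, (p.1 α : ℤ) + 1) p.2
  simp only [denHat] at h1
  rw [h1] at h2
  have e : (K + ∑ α, (n α : ℤ) + 1 + ((∑ α, p.1 α : ℕ) : ℤ)) =
      (K + ∑ α, (p.1 α : ℤ) + 1 + ((∑ α, n α : ℕ) : ℤ)) := by
    push_cast
    ring
  rw [e, h3] at h2
  simpa using h2

/-- The value at `y` of a linear function. -/
theorem aeval_lin (y : V → ℝ) (hy : ∀ v, y v = ∑ i, b.repr v i * y (b i)) (α : V) :
    MvPolynomial.aeval (fun i => y (b i)) (lin b α) = y α := by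
  rw [hy α]
  simp [lin]

end Algebra

/-! ### Chambers, locally polynomial functions, Laplace transforms -/

section Analysis

variable {V : Type*} [NormedAddCommGroup V] [NormedSpace ℝ V]

/-- The regular elements of the dual space. -/
def dualReg (Δ : Finset V) : Set (StrongDual ℝ V) := {y | ∀ α ∈ Δ, y α ≠ 0}

/-- The chambers of the dual space. -/
def IsDualChamber (Δ : Finset V) (δ : Set (StrongDual ℝ V)) : Prop :=
  ∃ y ∈ dualReg Δ, δ = connectedComponentIn (dualReg Δ) y

/-- A wall is a hyperplane generated by linearly independent elements of `Δ`. -/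
def IsWall (Δ : Finset V) (W : Submodule ℝ V) : Prop :=
  ∃ κ : Finset V, κ ⊆ Δ ∧ LinearIndepOn ℝ id (κ : Set V) ∧
    κ.card + 1 = Module.finrank ℝ V ∧ W = Submodule.span ℝ (κ : Set V)

/-- The regular elements of `V`. -/
def reg (Δ : Finset V) : Set V := {h | ∀ W : Submodule ℝ V, IsWall Δ W → h ∉ W}

/-- The chambers of `V`. -/
def IsChamber (Δ : Finset V) (γ : Set V) : Prop :=
  ∃ h ∈ reg Δ, γ = connectedComponentIn (reg Δ) h

/-- The closed cone dual to `δ`. -/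
def dualCone (δ : Set (StrongDual ℝ V)) : Set V := {h | ∀ y ∈ δ, 0 ≤ y h}

/-- `C(σ)`: the closed convex cone generated by `σ`. -/
def cone (σ : Finset V) : Set V := (PointedCone.hull ℝ (σ : Set V) : Set V)

variable {r : ℕ} (b : Module.Basis (Fin r) ℝ V) (Δ : Finset V)

/-- The value at a regular element `y` of a rational function with poles on the hyperplanes. -/
def evalAt (y : StrongDual ℝ V) (hy : y ∈ dualReg Δ) : R b Δ →+* ℝ :=
  IsLocalization.lift (M := denoms b Δ)
    (g := (MvPolynomial.aeval (fun i => y (b i)) : MvPolynomial (Fin r) ℝ →ₐ[ℝ] ℝ).toRingHom) <| by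
    rintro ⟨s, hs⟩
    induction hs using Submonoid.closure_induction with
    | mem x hx =>
      obtain ⟨α, hα, rfl⟩ := hx
      have h1 : MvPolynomial.aeval (fun i => y (b i)) (lin b α) = y α :=
        aeval_lin b y (fun v => by
          conv_lhs => rw [← b.sum_repr v]
          simp only [map_sum, map_smul, smul_eq_mul]) α
      have h2 := hy α hα
      exact isUnit_iff_ne_zero.mpr (by rw [← h1] at h2; exact h2)
    | one => simp
    | mul x z _ _ hx hz =>
      simp only [map_mul] at hx hz ⊢
      exact hx.mul hz

open Classical in
/-- The space `P_Δ(δ)` of locally polynomial functions on the regular elements of `V`, spanned by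
the `P [C(σ)]`, where `P` is a polynomial function and `σ` a basis of `Δ` with `C(σ) ⊆ δ^∨`. -/
def locPoly (δ : Set (StrongDual ℝ V)) : Submodule ℝ (reg Δ → ℝ) :=
  Submodule.span ℝ {f | ∃ σ ∈ bases Δ, cone σ ⊆ dualCone δ ∧ ∃ P : MvPolynomial (Fin r) ℝ,
    f = fun h : reg Δ => if (h : V) ∈ cone σ then MvPolynomial.eval (fun i => b.repr (h : V) i) P else 0}

/-- The form `dh` is positive for the orientation `o`. -/
def IsPos (o : Orientation ℝ V (Fin r)) (dh : V [⋀^Fin r]→ₗ[ℝ] ℝ) : Prop :=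
  ∃ hne : dh ≠ 0, rayOfNeZero ℝ dh hne = o

/-- The pairing of `⋀^r V` with alternating `r`-forms on `V`. -/
def pair (dy : ⋀[ℝ]^r V) (dh : V [⋀^Fin r]→ₗ[ℝ] ℝ) : ℝ :=
  exteriorPower.alternatingMapLinearEquiv dh dy

variable [MeasurableSpace V] [BorelSpace V] [FiniteDimensional ℝ V]
  [Fact (Module.finrank ℝ V = r)]

open Classical in
/-- The integral over the oriented space `V` of the form `F dh` of maximal degree. -/
def orientedIntegral (o : Orientation ℝ V (Fin r)) (dh : V [⋀^Fin r]→ₗ[ℝ] ℝ) (F : V → ℝ) : ℝ :=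
  (if IsPos o dh then 1 else -1) * ∫ h, F h ∂dh.measure

/-- `g ⊗ dy` is the Laplace transform of the locally polynomial function `f` (extended by `0` to
the complement of the regular elements, which has measure zero): for `y ∈ δ`, the integral of
`exp (-⟨y, h⟩) f(h) dh` converges and is `g(y) ⟨dy, dh⟩`. -/
def IsLaplace (o : Orientation ℝ V (Fin r)) (δ : Set (StrongDual ℝ V)) (f : reg Δ → ℝ)
    (g : R b Δ) (dy : ⋀[ℝ]^r V) : Prop :=
  ∀ (y : StrongDual ℝ V) (hy : y ∈ dualReg Δ), y ∈ δ → ∀ dh : V [⋀^Fin r]→ₗ[ℝ] ℝ,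
    Integrable (fun h => Real.exp (-(y h)) * Function.extend Subtype.val f 0 h) dh.measure ∧
    orientedIntegral o dh (fun h => Real.exp (-(y h)) * Function.extend Subtype.val f 0 h) =
      evalAt b Δ y hy g * pair dy dh

open Classical in
/-- The inverse Laplace transform `F_δ^o(φ ⊗ dy)`: the element of `P_Δ(δ)` whose Laplace transform
is `Princ_Δ(φ) ⊗ dy`. -/
def invLaplace (o : Orientation ℝ V (Fin r)) (δ : Set (StrongDual ℝ V)) (φ : RHat b Δ)
    (dy : ⋀[ℝ]^r V) : reg Δ → ℝ :=
  if hf : ∃! f, f ∈ locPoly b Δ δ ∧ IsLaplace b Δ o δ f (princ b Δ φ) dy then hf.choose else 0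

open Classical in
/-- The one of `α`, `-α` that is positive on `δ`. -/
def flip (δ : Set (StrongDual ℝ V)) (α : V) : V := if ∀ y ∈ δ, 0 < y α then α else -α

open Classical in
/-- `σ^δ`: the set with the same axes as `σ` and whose elements are positive on `δ`. -/
def flipSet (δ : Set (StrongDual ℝ V)) (σ : Finset V) : Finset V := σ.image (flip δ)

open Classical in
/-- The sign `ε(σ, δ)`, for which `φ_σ = ε(σ, δ) φ_{σ^δ}`. -/
def sign (δ : Set (StrongDual ℝ V)) (σ : Finset V) : ℝ :=
  ∏ α ∈ σ, if ∀ y ∈ δ, 0 < y α then 1 else -1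

/-- `vol(σ, dh)`: the volume of the parallelepiped constructed on `σ`. -/
def vol (σ : Finset V) (dh : V [⋀^Fin r]→ₗ[ℝ] ℝ) : ℝ :=
  dh.measure.real (parallelepiped (fun α : σ => (α : V)))

end Analysis

end

end JeffreyKirwan

/-! Everything reduces to fractions `frac b Δ m`, the product of the `α ^ (-m α)`, whose
denominators form a basis σ of `V`.

Partial fractions (`frac_mem_span`) make denominators linearly independent without changing their
span. When they form a basis, a linear numerator is a combination of them and cancels; hence `G_Δ +
NG_Δ = R_Δ` (`G_sup_NG`). The sum is direct because constant-coefficient differential operators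
separate the two spaces. If ξ vanishes on a non-generating set of denominators, a power of the
derivative along ξ kills the fraction, so every element of `NG_Δ` is killed by a product of nonzero
directional derivatives. Each such derivative preserves `G_Δ` and is injective on it: along a line
in direction ξ through a regular point, an element of `G_Δ` is a quotient of polynomials of negative
degree, so it vanishes if it is constant.

On the analytic side, changing signs makes every basis positive on δ. In the coordinates of such a
basis the Laplace integral is a product of Gamma integrals: up to the volume of the parallelepiped,
`frac b Δ m` is the transform of the product of the `x_α ^ (m α - 1) / (m α - 1)!` on `C(σ)`
(`laplace_coneFun`). This gives existence. For uniqueness, a function whose Laplace transform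
vanishes on an open set is zero almost everywhere (`ae_eq_zero_of_laplace_eq_zero`), and elements of
`P_Δ(δ)` are continuous on `V_reg`, where cones are clopen.

On the algebraic side, expanding `e^h` in powers of the elements of σ shows that `Res_Δ(e^h frac b Δ
m)` is `φ_σ` times the same monomial, evaluated at the coordinates of `h` (`res_exp_mul_frac`).
Since `φ_σ` is, up to volume, the transform of the characteristic function of `C(σ)`, the two
inverse transforms agree at `h`: this is the Jeffrey-Kirwan formula. The chamber formula follows by
inverting each `φ_σ` after the change of signs. -/

namespace JeffreyKirwan

noncomputable section

/-! ### Exponents as finitely supported functions. -/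

section Exponents

variable {V : Type*} {Δ : Finset V}

theorem setOf_exponents {m : V →₀ ℕ} (hm : m.support ⊆ Δ) :
    {v : V | ∃ α : Δ, m α ≠ 0 ∧ (α : V) = v} = (m.support : Set V) := by
  ext v
  simp only [Set.mem_ofPred_eq, Finset.mem_coe, Finsupp.mem_support_iff]
  constructor
  · rintro ⟨α, h, rfl⟩
    exact h
  · intro h
    exact ⟨⟨v, hm (Finsupp.mem_support_iff.mpr h)⟩, h, rfl⟩

theorem support_add_single {m : V →₀ ℕ} {α : V} [DecidableEq V] :
    (m + Finsupp.single α 1).support = insert α m.support := by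
  ext v
  by_cases h : α = v
  · subst h; simp
  · simp [Ne.symm h]

/-- Exponents are carried by finitely supported functions on `V` rather than functions on the
subtype `Δ`: these have supports that are sets of vectors, and can be pushed forward along `flip`.
-/
theorem exists_finsupp (n : Δ → ℕ) : ∃ m : V →₀ ℕ, m.support ⊆ Δ ∧ n = fun α : Δ => m α := by
  classical
  refine ⟨Finsupp.onFinset Δ (fun v => if h : v ∈ Δ then n ⟨v, h⟩ else 0) ?_,
    Finsupp.support_onFinset_subset, ?_⟩
  · intro a ha
    by_contra h
    simp [h] at ha
  · ext α
    simp

end Exponents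

theorem inverse_neg_eq {A : Type*} [CommRing A] (x : A) :
    Ring.inverse (-x) = -Ring.inverse x := by
  by_cases h : IsUnit x
  · refine h.neg.mul_left_cancel ?_
    rw [Ring.mul_inverse_cancel _ h.neg, neg_mul_neg, Ring.mul_inverse_cancel _ h]
  · rw [Ring.inverse_non_unit _ h, Ring.inverse_non_unit _ (by rwa [IsUnit.neg_iff]), neg_zero]

/-! ### Partial fractions, and `R_Δ = G_Δ + NG_Δ`. -/

section Fractions

variable {V : Type*} [AddCommGroup V] [Module ℝ V] {r : ℕ} (b : Module.Basis (Fin r) ℝ V)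
  (Δ : Finset V)

variable {b Δ} in
theorem algebraMap_C_mul (c : ℝ) (x : R b Δ) :
    algebraMap (MvPolynomial (Fin r) ℝ) (R b Δ) (MvPolynomial.C c) * x = c • x := by
  rw [← algebraMap_smul (MvPolynomial (Fin r) ℝ) c, Algebra.smul_def]
  rfl

/-- The linear functions, as elements of `R_Δ`. -/
def linR : V →ₗ[ℝ] R b Δ where
  toFun α := algebraMap (MvPolynomial (Fin r) ℝ) (R b Δ) (lin b α)
  map_add' α β := by
    rw [← map_add]
    congr 1
    simp [lin, add_mul, Finset.sum_add_distrib]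
  map_smul' c α := by
    rw [RingHom.id_apply, ← algebraMap_C_mul, ← map_mul]
    congr 1
    simp [lin, Finset.mul_sum, mul_assoc]

theorem linR_apply (α : V) :
    linR b Δ α = algebraMap (MvPolynomial (Fin r) ℝ) (R b Δ) (lin b α) := rfl

theorem lin_basis (i : Fin r) : lin b (b i) = MvPolynomial.X i := by
  classical
  simp [lin, Finsupp.single_apply, Finset.sum_ite_eq]

/-- The inverse of the linear function `α`. -/
def pinv (α : V) : R b Δ := Ring.inverse (linR b Δ α)

variable {b Δ}

theorem linR_mul_pinv {α : V} (hα : α ∈ Δ) : linR b Δ α * pinv b Δ α = 1 :=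
  Ring.mul_inverse_cancel _ <|
    IsLocalization.map_units (R b Δ) (⟨lin b α, Submonoid.subset_closure
      (Set.mem_image_of_mem (lin b) (Finset.mem_coe.mpr hα))⟩ : denoms b Δ)

/-- Holds for every vector, in `Δ` or not, because `Ring.inverse` is zero at non-units and negation
preserves units. -/
theorem pinv_neg (α : V) : pinv b Δ (-α) = -pinv b Δ α :=
  (congrArg Ring.inverse (map_neg (linR b Δ) α)).trans (inverse_neg_eq _)

variable (b Δ)

/-- The fraction `1 / ∏ α ^ n α`. -/
def frac (n : V →₀ ℕ) : R b Δ := n.prod fun α k => pinv b Δ α ^ k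

variable {b Δ}

@[simp] theorem frac_zero : frac b Δ 0 = 1 := Finsupp.prod_zero_index

theorem frac_add (m n : V →₀ ℕ) : frac b Δ (m + n) = frac b Δ m * frac b Δ n := by
  classical
  exact Finsupp.prod_add_index' (by simp) (by simp [pow_add])

theorem frac_single (α : V) (k : ℕ) : frac b Δ (Finsupp.single α k) = pinv b Δ α ^ k :=
  Finsupp.prod_single_index (by simp)

theorem linR_mul_frac {α : V} (hα : α ∈ Δ) (m : V →₀ ℕ) :
    linR b Δ α * frac b Δ (m + Finsupp.single α 1) = frac b Δ m := by
  rw [frac_add, frac_single, pow_one, mul_comm (frac b Δ m), ← mul_assoc, linR_mul_pinv hα, one_mul]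

theorem mk_den (ψ : MvPolynomial (Fin r) ℝ) {m : V →₀ ℕ} (hm : m.support ⊆ Δ) :
    (Localization.mk ψ (den b Δ fun α => m α) : R b Δ) = algebraMap _ (R b Δ) ψ * frac b Δ m := by
  have h1 : algebraMap _ (R b Δ) (den b Δ fun α => m α : MvPolynomial (Fin r) ℝ) * frac b Δ m = 1 := by
    rw [frac, Finsupp.prod_of_support_subset m hm _ (by simp), den, ← Finset.prod_coe_sort Δ,
      map_prod, ← Finset.prod_mul_distrib]
    refine Finset.prod_eq_one fun α _ => ?_
    rw [map_pow, ← mul_pow, ← linR_apply, linR_mul_pinv α.2, one_pow]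
  have h2 : (Localization.mk ψ (den b Δ fun α => m α) : R b Δ) *
      algebraMap _ (R b Δ) (den b Δ fun α => m α : MvPolynomial (Fin r) ℝ) =
      algebraMap _ (R b Δ) ψ := by
    rw [Localization.mk_eq_mk', IsLocalization.mk'_spec]
  rw [← h2, mul_assoc, h1, mul_one]

theorem exists_eq_mul_frac (x : R b Δ) : ∃ (ψ : MvPolynomial (Fin r) ℝ) (m : V →₀ ℕ),
    m.support ⊆ Δ ∧ x = algebraMap _ (R b Δ) ψ * frac b Δ m := by
  induction x using Localization.induction_on with
  | H y =>
    obtain ⟨ψ, s⟩ := y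
    obtain ⟨n, hn⟩ := exists_den b Δ s.2
    obtain ⟨m, hm, rfl⟩ := exists_finsupp n
    exact ⟨ψ, m, hm, by rw [← mk_den ψ hm, Subtype.ext hn.symm]⟩

/-- Partial fractions: one step, using a linear relation between the denominators. -/
theorem frac_eq_sum_of_relation {m : V →₀ ℕ} {β : V} (hβΔ : β ∈ Δ) {c : V → ℝ} {s : Finset V}
    (hβ : β = ∑ α ∈ s, c α • α) :
    frac b Δ m = ∑ α ∈ s, c α • (linR b Δ α * frac b Δ (m + Finsupp.single β 1)) := by
  rw [← linR_mul_frac hβΔ m]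
  conv_lhs => rw [hβ]
  rw [map_sum, Finset.sum_mul]
  rw [← hβ]
  exact Finset.sum_congr rfl fun α _ => by rw [map_smul, smul_mul_assoc]

/-- The outer induction is on the number of distinct denominators. If they are dependent, fix β with
nonzero coefficient in a relation and write β as a combination of the others. Multiplying by `β / β`
trades a power of some α for a power of β, so the inner induction is on the total exponent away from
β. It ends when some α disappears; the span is unchanged, since that α is a combination of the
remaining denominators. -/
theorem frac_mem_span_of_card (k : ℕ) : ∀ n : V →₀ ℕ, n.support ⊆ Δ → n.support.card ≤ k →
    frac b Δ n ∈ Submodule.span ℝ {x | ∃ m : V →₀ ℕ, m.support ⊆ Δ ∧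
      LinearIndepOn ℝ id (m.support : Set V) ∧
      Submodule.span ℝ (m.support : Set V) = Submodule.span ℝ (n.support : Set V) ∧
      x = frac b Δ m} := by
  classical
  induction k with
  | zero =>
    intro n hn hk
    refine Submodule.subset_span ⟨n, hn, ?_, rfl, rfl⟩
    rw [Finset.card_eq_zero.mp (Nat.le_zero.mp hk)]
    simp
  | succ k ih =>
    intro n hn hk
    by_cases hli : LinearIndepOn ℝ id (n.support : Set V)
    · exact Submodule.subset_span ⟨n, hn, hli, rfl, rfl⟩
    obtain ⟨f, hf, β, hβ, hfβ⟩ := not_linearIndepOn_finset_iff.mp hli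
    have hrel : β = ∑ α ∈ n.support.erase β, (-(f β)⁻¹ * f α) • α := by
      simp only [id] at hf
      rw [← Finset.add_sum_erase _ _ hβ, add_eq_zero_iff_eq_neg] at hf
      simp only [mul_smul, ← Finset.smul_sum]
      rw [neg_smul, ← smul_neg, ← hf, smul_smul, inv_mul_cancel₀ hfβ, one_smul]
    set κ := n.support with hκ
    have key : ∀ N : ℕ, ∀ n' : V →₀ ℕ, n'.support = κ → ∑ α ∈ κ.erase β, n' α ≤ N →
        frac b Δ n' ∈ Submodule.span ℝ {x | ∃ m : V →₀ ℕ, m.support ⊆ Δ ∧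
          LinearIndepOn ℝ id (m.support : Set V) ∧
          Submodule.span ℝ (m.support : Set V) = Submodule.span ℝ (κ : Set V) ∧
          x = frac b Δ m} := by
      intro N
      induction N with
      | zero =>
        intro n' hn' hN
        -- With no exponent left away from β, the relation reads `β = 0` and the fraction is an
        -- empty sum.
        have hemp : κ.erase β = ∅ := by
          by_contra hne
          obtain ⟨α, hα⟩ := Finset.nonempty_iff_ne_empty.mpr hne
          have h1 := Finset.sum_eq_zero_iff.mp (Nat.le_zero.mp hN) α hα
          have h2 : α ∈ n'.support := hn' ▸ Finset.mem_of_mem_erase hα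
          exact Finsupp.mem_support_iff.mp h2 h1
        rw [frac_eq_sum_of_relation (hn hβ) hrel, hemp, Finset.sum_empty]
        exact Submodule.zero_mem _
      | succ N ihN =>
        intro n' hn' hN
        rw [frac_eq_sum_of_relation (hn hβ) hrel]
        refine Submodule.sum_mem _ fun α hα => ?_
        by_cases hfα : f α = 0
        · simp [hfα]
        refine Submodule.smul_mem _ _ ?_
        have hακ := Finset.mem_of_mem_erase hα
        have hαβ := Finset.ne_of_mem_erase hα
        have hα1 : 1 ≤ n' α := Nat.one_le_iff_ne_zero.mpr
          (Finsupp.mem_support_iff.mp (hn'.symm ▸ hακ))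
        set m := n' - Finsupp.single α 1 + Finsupp.single β 1 with hm
        have hm1 : n' + Finsupp.single β 1 = m + Finsupp.single α 1 := by
          ext v
          simp only [hm, Finsupp.add_apply, Finsupp.tsub_apply, Finsupp.single_apply]
          split_ifs with h1 h2 h2 <;> subst_vars <;> omega
        rw [hm1, linR_mul_frac (hn hακ)]
        have hmv : ∀ v, v ≠ α → v ≠ β → m v = n' v := by
          intro v h1 h2
          simp [hm, Ne.symm h1, Ne.symm h2]
        have hmβ : m β = n' β + 1 := by
          simp [hm, hαβ]
        have hmα : m α = n' α - 1 := by
          simp [hm, hαβ.symm]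
        -- Either α disappears and the outer induction applies, or the support stays κ and the total
        -- exponent away from β drops by one.
        by_cases h1 : n' α = 1
        · have hsupp : m.support = κ.erase α := by
            ext v
            rw [Finset.mem_erase, ← hn', Finsupp.mem_support_iff, Finsupp.mem_support_iff]
            by_cases hvα : v = α
            · subst hvα; simp [hmα, h1]
            · by_cases hvβ : v = β
              · subst hvβ
                simp [hmβ, hvα, Finsupp.mem_support_iff.mp (hn'.symm ▸ hβ)]
              · simp [hmv v hvα hvβ, hvα]
          have hspan : Submodule.span ℝ (m.support : Set V) = Submodule.span ℝ (κ : Set V) := by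
            rw [hsupp]
            apply le_antisymm (Submodule.span_mono (by simp))
            rw [Submodule.span_le]
            intro v hv
            by_cases hvα : v = α
            · subst hvα
              simp only [id] at hf
              rw [← Finset.add_sum_erase _ _ hακ, add_eq_zero_iff_eq_neg] at hf
              have : v = (f v)⁻¹ • -∑ x ∈ κ.erase v, f x • x := by
                rw [← hf, smul_smul, inv_mul_cancel₀ hfα, one_smul]
              have hmem : (f v)⁻¹ • -∑ x ∈ κ.erase v, f x • x ∈
                  Submodule.span ℝ ((κ.erase v : Finset V) : Set V) :=
                Submodule.smul_mem _ _ (Submodule.neg_mem _ (Submodule.sum_mem _ fun x hx =>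
                  Submodule.smul_mem _ _ (Submodule.subset_span (Finset.mem_coe.mpr hx))))
              rwa [← this] at hmem
            · exact Submodule.subset_span (Finset.mem_coe.mpr (Finset.mem_erase.mpr ⟨hvα, hv⟩))
          have := ih m (hsupp ▸ (Finset.erase_subset _ _).trans hn) (by
            rw [hsupp, Finset.card_erase_of_mem hακ]; omega)
          rwa [hspan] at this
        · have hsupp : m.support = κ := by
            ext v
            rw [← hn', Finsupp.mem_support_iff, Finsupp.mem_support_iff]
            by_cases hvα : v = α
            · subst hvα; rw [hmα]; omega
            · by_cases hvβ : v = β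
              · subst hvβ
                simp [hmβ, Finsupp.mem_support_iff.mp (hn'.symm ▸ hβ)]
              · simp [hmv v hvα hvβ]
          refine ihN m hsupp ?_
          have hlt : ∑ x ∈ κ.erase β, m x < ∑ x ∈ κ.erase β, n' x := by
            refine Finset.sum_lt_sum (fun x hx => ?_) ⟨α, hα, by omega⟩
            by_cases hxα : x = α
            · subst hxα; omega
            · rw [hmv x hxα (Finset.ne_of_mem_erase hx)]
          omega
    exact key _ n rfl le_rfl

/-- Partial fractions: every `1 / ∏ α ^ n α` is a combination of such fractions with linearly
independent denominators that generate the same subspace. -/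
theorem frac_mem_span {n : V →₀ ℕ} (hn : n.support ⊆ Δ) :
    frac b Δ n ∈ Submodule.span ℝ {x | ∃ m : V →₀ ℕ, m.support ⊆ Δ ∧
      LinearIndepOn ℝ id (m.support : Set V) ∧
      Submodule.span ℝ (m.support : Set V) = Submodule.span ℝ (n.support : Set V) ∧
      x = frac b Δ m} :=
  frac_mem_span_of_card _ n hn le_rfl

theorem mem_bases {σ : Finset V} : σ ∈ bases Δ ↔ σ ⊆ Δ ∧
    LinearIndepOn ℝ id (σ : Set V) ∧ Submodule.span ℝ (σ : Set V) = ⊤ := by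
  simp [bases]

theorem frac_mem_G {m : V →₀ ℕ} (hm : m.support ⊆ Δ)
    (hspan : Submodule.span ℝ (m.support : Set V) = ⊤) : frac b Δ m ∈ G b Δ :=
  Submodule.subset_span ⟨fun α => m α, by rw [setOf_exponents hm, hspan],
    by rw [mk_den 1 hm, map_one, one_mul]⟩

theorem G_eq_span :
    G b Δ = Submodule.span ℝ {x | ∃ m : V →₀ ℕ, m.support ∈ bases Δ ∧ x = frac b Δ m} := by
  apply le_antisymm
  · rw [G, Submodule.span_le]
    rintro _ ⟨n, hn, rfl⟩
    obtain ⟨m, hm, rfl⟩ := exists_finsupp n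
    rw [setOf_exponents hm] at hn
    rw [mk_den 1 hm, map_one, one_mul]
    refine Submodule.span_mono ?_ (frac_mem_span hm)
    rintro _ ⟨m', h1, h2, h3, rfl⟩
    exact ⟨m', mem_bases.mpr ⟨h1, h2, h3.trans hn⟩, rfl⟩
  · rw [Submodule.span_le]
    rintro _ ⟨m, hm, rfl⟩
    rw [mem_bases] at hm
    exact frac_mem_G hm.1 hm.2.2

theorem mul_frac_mem_NG {m : V →₀ ℕ} (hm : m.support ⊆ Δ)
    (hspan : Submodule.span ℝ (m.support : Set V) ≠ ⊤) (ψ : MvPolynomial (Fin r) ℝ) :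
    algebraMap _ (R b Δ) ψ * frac b Δ m ∈ NG b Δ :=
  Submodule.subset_span ⟨fun α => m α, ψ, by rwa [setOf_exponents hm], (mk_den ψ hm).symm⟩

theorem NG_induction {p : R b Δ → Prop} (hzero : p 0) (hadd : ∀ x y, p x → p y → p (x + y))
    (hsmul : ∀ (c : ℝ) x, p x → p (c • x))
    (hfrac : ∀ (m : V →₀ ℕ), m.support ⊆ Δ → Submodule.span ℝ (m.support : Set V) ≠ ⊤ →
      ∀ ψ : MvPolynomial (Fin r) ℝ, p (algebraMap _ (R b Δ) ψ * frac b Δ m))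
    {x : R b Δ} (hx : x ∈ NG b Δ) : p x := by
  refine Submodule.span_induction ?_ hzero (fun x y _ _ => hadd x y) (fun c x _ => hsmul c x) hx
  rintro _ ⟨n, ψ, hn, rfl⟩
  obtain ⟨m, hm, rfl⟩ := exists_finsupp n
  rw [setOf_exponents hm] at hn
  rw [mk_den ψ hm]
  exact hfrac m hm hn ψ

/-- By partial fractions, a linear statement on `G_Δ` need only be checked when the denominators
form a basis. -/
theorem G_induction {p : R b Δ → Prop} (hzero : p 0) (hadd : ∀ x y, p x → p y → p (x + y))
    (hsmul : ∀ (c : ℝ) x, p x → p (c • x))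
    (hfrac : ∀ (m : V →₀ ℕ), m.support ∈ bases Δ → p (frac b Δ m))
    {x : R b Δ} (hx : x ∈ G b Δ) : p x := by
  rw [G_eq_span] at hx
  refine Submodule.span_induction ?_ hzero (fun x y _ _ => hadd x y) (fun c x _ => hsmul c x) hx
  rintro _ ⟨m, hm, rfl⟩
  exact hfrac m hm

/-- While the denominators span, each variable is a combination of them and cancels one power; once
they stop spanning, the fraction is in `NG_Δ` whatever its numerator. The exponents are quantified
after ψ because they decrease along the induction. -/
theorem mul_frac_mem_sup (ψ : MvPolynomial (Fin r) ℝ) : ∀ m : V →₀ ℕ, m.support ⊆ Δ →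
    LinearIndepOn ℝ id (m.support : Set V) →
    algebraMap _ (R b Δ) ψ * frac b Δ m ∈ G b Δ ⊔ NG b Δ := by
  classical
  induction ψ using MvPolynomial.induction_on with
  | C a =>
    intro m hm hli
    by_cases hspan : Submodule.span ℝ (m.support : Set V) = ⊤
    · rw [algebraMap_C_mul]
      exact Submodule.smul_mem _ _ (Submodule.mem_sup_left (frac_mem_G hm hspan))
    · exact Submodule.mem_sup_right (mul_frac_mem_NG hm hspan _)
  | add p q hp hq =>
    intro m hm hli
    rw [map_add, add_mul]
    exact Submodule.add_mem _ (hp m hm hli) (hq m hm hli)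
  | mul_X p i ih =>
    intro m hm hli
    by_cases hspan : Submodule.span ℝ (m.support : Set V) = ⊤
    · have hmem : b i ∈ Submodule.span ℝ (m.support : Set V) := hspan ▸ Submodule.mem_top
      obtain ⟨c, -, hc⟩ := Submodule.mem_span_finset.mp hmem
      rw [map_mul, ← lin_basis b i, ← linR_apply, ← hc, map_sum, Finset.mul_sum, Finset.sum_mul]
      refine Submodule.sum_mem _ fun α hα => ?_
      have hα1 : 1 ≤ m α := Nat.one_le_iff_ne_zero.mpr (Finsupp.mem_support_iff.mp hα)
      have hm1 : m = (m - Finsupp.single α 1) + Finsupp.single α 1 := by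
        rw [tsub_add_cancel_of_le]
        simpa using hα1
      have hsub : (m - Finsupp.single α 1).support ⊆ m.support := Finsupp.support_tsub
      rw [map_smul, mul_smul_comm, smul_mul_assoc, mul_assoc, hm1, linR_mul_frac (hm hα)]
      exact Submodule.smul_mem _ _ (ih _ (hsub.trans hm) (hli.mono (by exact_mod_cast hsub)))
    · exact Submodule.mem_sup_right (mul_frac_mem_NG hm hspan _)

theorem G_sup_NG : G b Δ ⊔ NG b Δ = ⊤ := by
  rw [eq_top_iff]
  rintro x -
  obtain ⟨ψ, n, hn, rfl⟩ := exists_eq_mul_frac x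
  have h := frac_mem_span (b := b) hn
  generalize frac b Δ n = x at h
  induction h using Submodule.span_induction with
  | mem x hx =>
    obtain ⟨m, h1, h2, -, rfl⟩ := hx
    exact mul_frac_mem_sup ψ m h1 h2
  | zero => simp
  | add x y _ _ hx hy => rw [mul_add]; exact Submodule.add_mem _ hx hy
  | smul c x _ hx => rw [mul_smul_comm]; exact Submodule.smul_mem _ _ hx

end Fractions

/-! ### Extension of derivations to localizations. -/

section Derivations

variable {k A S : Type*} [CommRing k] [CommRing A] [CommRing S] [Algebra k A] [Algebra k S]
  [Algebra A S] [IsScalarTower k A S]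

/-- A derivation of a ring extends to its localizations. -/
theorem exists_derivation_localization (M : Submonoid A) [IsLocalization M S] (d : Derivation k A A) :
    ∃ D : Derivation k S S, ∀ a, D (algebraMap A S a) = algebraMap A S (d a) := by
  -- A derivation is the same as a homomorphism `a ↦ a + ε d a` to dual numbers. It extends to the
  -- localization because a dual number is a unit as soon as its first component is one.
  let f : A →ₐ[k] TrivSqZeroExt S S :=
    { toFun := fun a => TrivSqZeroExt.inl (algebraMap A S a) + TrivSqZeroExt.inr (algebraMap A S (d a))
      map_one' := by ext <;> simp
      map_mul' := fun x y => by
        ext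
        · simp
        · simp only [TrivSqZeroExt.snd_mul, TrivSqZeroExt.snd_add, TrivSqZeroExt.snd_inl,
            TrivSqZeroExt.snd_inr, TrivSqZeroExt.fst_add, TrivSqZeroExt.fst_inl,
            TrivSqZeroExt.fst_inr, zero_add, add_zero, Derivation.leibniz, map_add, map_mul,
            smul_eq_mul, op_smul_eq_mul]
          ring
      map_zero' := by ext <;> simp
      map_add' := fun x y => by ext <;> simp [Algebra.smul_def]
      commutes' := fun c => by
        ext
        · simp [TrivSqZeroExt.algebraMap_eq_inl', ← IsScalarTower.algebraMap_apply]
        · simp [TrivSqZeroExt.algebraMap_eq_inl'] }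
  have hf : ∀ y : M, IsUnit (f y) := fun y => by
    rw [TrivSqZeroExt.isUnit_iff_isUnit_fst]
    simpa [f] using IsLocalization.map_units S y
  let F : S →ₐ[k] TrivSqZeroExt S S := IsLocalization.liftAlgHom (M := M) (f := f) hf
  have hF : ∀ a, F (algebraMap A S a) = f a := fun a => by
    simp [F, IsLocalization.liftAlgHom_apply]
  have hfst : ∀ x, (F x).fst = x := by
    have : ((TrivSqZeroExt.fstHom S S S).toRingHom.comp F.toRingHom) = RingHom.id S := by
      refine IsLocalization.ringHom_ext M (RingHom.ext fun a => ?_)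
      simp [hF, f]
    exact fun x => congrArg (fun g : S →+* S => g x) this
  refine ⟨Derivation.mk' ((TrivSqZeroExt.sndHom S S).restrictScalars k ∘ₗ F.toLinearMap) ?_, ?_⟩
  · intro x y
    simp [hfst, mul_comm]
  · intro a
    change (F (algebraMap A S a)).snd = _
    rw [hF]
    exact zero_add _

theorem derivation_eq_zero_of_localization {k A S : Type*} [CommRing k] [CommRing A] [CommRing S]
    [Algebra k S] [Algebra A S] (M : Submonoid A) [IsLocalization M S] (E : Derivation k S S)
    (hE : ∀ a, E (algebraMap A S a) = 0) (x : S) : E x = 0 := by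
  obtain ⟨a, s, rfl⟩ := IsLocalization.exists_mk'_eq M x
  have h := congrArg E (IsLocalization.mk'_spec S a s)
  rw [Derivation.leibniz, hE, hE, smul_zero, zero_add, smul_eq_mul] at h
  exact (IsLocalization.map_units S s).mul_right_eq_zero.mp h

theorem derivation_comm_of_localization {k A S : Type*} [CommRing k] [CommRing A] [CommRing S]
    [Algebra k A] [Algebra k S] [Algebra A S] (M : Submonoid A) [IsLocalization M S]
    {D D' : Derivation k S S} {d d' : Derivation k A A}
    (hD : ∀ a, D (algebraMap A S a) = algebraMap A S (d a))
    (hD' : ∀ a, D' (algebraMap A S a) = algebraMap A S (d' a))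
    (hcomm : ∀ a, d (d' a) = d' (d a)) (x : S) : D (D' x) = D' (D x) := by
  rw [← sub_eq_zero, ← Derivation.commutator_apply]
  refine derivation_eq_zero_of_localization M _ (fun a => ?_) x
  rw [Derivation.commutator_apply, hD, hD', hD, hD', hcomm, sub_self]

end Derivations

theorem eq_neg_smul_of_add_eq_zero {E : Type*} [AddCommGroup E] [Module ℝ E] {x y : E} {c : ℝ}
    (h : x + c • y = 0) : x = (-c) • y := by
  rw [neg_smul]
  exact eq_neg_of_add_eq_zero_left h

/-- The hypothesis says that `P / Q` has zero derivative. Comparing leading coefficients gives equal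
degrees if `P` is nonzero, in characteristic zero. -/
theorem polynomial_eq_zero_of_wronskian {P Q : Polynomial ℝ} (hdeg : P.degree < Q.degree)
    (h : Polynomial.derivative P * Q = P * Polynomial.derivative Q) : P = 0 := by
  by_contra hP
  have hQ : Q ≠ 0 := by rintro rfl; simp at hdeg
  have h1 := congrArg Polynomial.leadingCoeff h
  simp only [Polynomial.leadingCoeff_mul, Polynomial.leadingCoeff_derivative] at h1
  have h2 : (P.natDegree : ℝ) = Q.natDegree := by
    have hp := Polynomial.leadingCoeff_ne_zero.mpr hP
    have hq := Polynomial.leadingCoeff_ne_zero.mpr hQ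
    have : (P.leadingCoeff * Q.leadingCoeff) * ((P.natDegree : ℝ) - Q.natDegree) = 0 := by linarith
    rcases mul_eq_zero.mp this with h | h
    · exact absurd h (mul_ne_zero hp hq)
    · linarith
  have h3 := Polynomial.natDegree_lt_natDegree hP hdeg
  have : P.natDegree = Q.natDegree := by exact_mod_cast h2
  omega

/-! ### Directional derivatives on polynomials and on `R_Δ`. -/

section Directional

variable {V : Type*} [AddCommGroup V] [Module ℝ V] {r : ℕ} (b : Module.Basis (Fin r) ℝ V)
  (Δ : Finset V)

/-- The directional derivative along `ξ` on polynomial functions on the dual space. -/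
def polyDer (ξ : V →ₗ[ℝ] ℝ) : Derivation ℝ (MvPolynomial (Fin r) ℝ) (MvPolynomial (Fin r) ℝ) :=
  MvPolynomial.mkDerivation ℝ fun i => MvPolynomial.C (ξ (b i))

variable {b} in
theorem apply_eq_sum_repr (ξ : V →ₗ[ℝ] ℝ) (α : V) : ξ α = ∑ i, b.repr α i * ξ (b i) := by
  conv_lhs => rw [← b.sum_repr α]
  simp only [map_sum, map_smul, smul_eq_mul]

theorem polyDer_lin (ξ : V →ₗ[ℝ] ℝ) (α : V) : polyDer b ξ (lin b α) = MvPolynomial.C (ξ α) := by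
  rw [apply_eq_sum_repr (b := b) ξ α, lin]
  simp only [map_sum, polyDer, Derivation.leibniz, MvPolynomial.mkDerivation_X, smul_eq_mul,
    MvPolynomial.derivation_C, mul_zero, add_zero, map_mul]

theorem polyDer_comm (ξ η : V →ₗ[ℝ] ℝ) (p : MvPolynomial (Fin r) ℝ) :
    polyDer b ξ (polyDer b η p) = polyDer b η (polyDer b ξ p) := by
  rw [← sub_eq_zero, ← Derivation.commutator_apply]
  have : ⁅polyDer b ξ, polyDer b η⁆ = 0 := by
    refine MvPolynomial.derivation_ext fun i => ?_
    simp [Derivation.commutator_apply, polyDer, MvPolynomial.mkDerivation_X]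
  rw [this, Derivation.zero_apply]

theorem exists_iterate_polyDer_eq_zero (ξ : V →ₗ[ℝ] ℝ) (p : MvPolynomial (Fin r) ℝ) :
    ∃ N, (polyDer b ξ)^[N] p = 0 := by
  have hz : ∀ N, (polyDer b ξ)^[N] 0 = 0 := fun N =>
    Function.iterate_fixed (map_zero _) N
  have hadd : ∀ N p q, (polyDer b ξ)^[N] (p + q) = (polyDer b ξ)^[N] p + (polyDer b ξ)^[N] q :=
    fun N p q => iterate_map_add (polyDer b ξ) N p q
  induction p using MvPolynomial.induction_on with
  | C a => exact ⟨1, by simp [polyDer]⟩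
  | add p q hp hq =>
    obtain ⟨N, hN⟩ := hp
    obtain ⟨M, hM⟩ := hq
    refine ⟨N + M, ?_⟩
    rw [hadd, Function.iterate_add_apply _ N M q, hM, hz, Nat.add_comm, Function.iterate_add_apply,
      hN, hz, add_zero]
  | mul_X p i hp =>
    obtain ⟨N, hN⟩ := hp
    -- Leibniz' rule stops after two terms because the derivative of a variable is constant; the
    -- value `(N + 1) * ξ (b i)` of `c` is irrelevant.
    have key : ∀ N, ∃ c : ℝ, (polyDer b ξ)^[N + 1] (p * MvPolynomial.X i) =
        (polyDer b ξ)^[N + 1] p * MvPolynomial.X i + MvPolynomial.C c * (polyDer b ξ)^[N] p := by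
      intro N
      induction N with
      | zero =>
        refine ⟨ξ (b i), ?_⟩
        simp [polyDer, MvPolynomial.mkDerivation_X]
        ring
      | succ N ih =>
        obtain ⟨c, hc⟩ := ih
        refine ⟨c + ξ (b i), ?_⟩
        rw [Function.iterate_succ_apply', hc, Function.iterate_succ_apply' _ (N + 1) p,
          Function.iterate_succ_apply' _ N p]
        simp [polyDer, MvPolynomial.mkDerivation_X]
        ring
    obtain ⟨c, hc⟩ := key N
    exact ⟨N + 1, by rw [hc, Function.iterate_succ_apply', hN]; simp⟩

/-- The directional derivative along `ξ` on `R_Δ`. -/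
def der (ξ : V →ₗ[ℝ] ℝ) : Derivation ℝ (R b Δ) (R b Δ) :=
  (exists_derivation_localization (denoms b Δ) (polyDer b ξ)).choose

variable {b Δ}

theorem der_algebraMap (ξ : V →ₗ[ℝ] ℝ) (p : MvPolynomial (Fin r) ℝ) :
    der b Δ ξ (algebraMap _ (R b Δ) p) = algebraMap _ (R b Δ) (polyDer b ξ p) :=
  (exists_derivation_localization (S := R b Δ) (denoms b Δ) (polyDer b ξ)).choose_spec p

theorem der_comm (ξ η : V →ₗ[ℝ] ℝ) (x : R b Δ) :
    der b Δ ξ (der b Δ η x) = der b Δ η (der b Δ ξ x) :=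
  derivation_comm_of_localization (denoms b Δ) (der_algebraMap ξ) (der_algebraMap η)
    (polyDer_comm b ξ η) x

theorem der_pinv (ξ : V →ₗ[ℝ] ℝ) {α : V} (hα : α ∈ Δ) :
    der b Δ ξ (pinv b Δ α) = (-ξ α) • (pinv b Δ α * pinv b Δ α) := by
  have h1 := congrArg (der b Δ ξ) (linR_mul_pinv (b := b) hα)
  rw [Derivation.leibniz, Derivation.map_one_eq_zero, linR_apply, der_algebraMap, polyDer_lin,
    smul_eq_mul, smul_eq_mul, ← linR_apply, mul_comm (pinv b Δ α), algebraMap_C_mul] at h1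
  have h2 := congrArg (fun x => pinv b Δ α * x) h1
  simp only [mul_add, mul_zero] at h2
  rw [← mul_assoc, mul_comm (pinv b Δ α), linR_mul_pinv hα, one_mul, mul_smul_comm] at h2
  exact eq_neg_smul_of_add_eq_zero h2

/-- Stated as a logarithmic derivative, which is additive in the exponents. -/
theorem der_frac_eq_mul (ξ : V →ₗ[ℝ] ℝ) (m : V →₀ ℕ) : m.support ⊆ Δ →
    der b Δ ξ (frac b Δ m) =
      m.sum (fun α k => (k : ℝ) • (-ξ α) • pinv b Δ α) * frac b Δ m := by
  classical
  induction m using Finsupp.induction_linear with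
  | zero => simp
  | add f g hf hg =>
    intro hm
    have h1 : f.support ⊆ Δ := (Finsupp.support_mono (self_le_add_right f g)).trans hm
    have h2 : g.support ⊆ Δ := (Finsupp.support_mono (self_le_add_left g f)).trans hm
    rw [frac_add, Derivation.leibniz, hf h1, hg h2, Finsupp.sum_add_index' (by simp)
      (fun α x y => by rw [Nat.cast_add, add_smul]), smul_eq_mul, smul_eq_mul]
    ring
  | single α k =>
    intro hm
    rcases Nat.eq_zero_or_pos k with rfl | hk
    · simp
    have hα : α ∈ Δ := hm (by simp [hk.ne'])
    obtain ⟨k, rfl⟩ : ∃ j, k = j + 1 := ⟨k - 1, by omega⟩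
    rw [Finsupp.sum_single_index (by simp), frac_single, Derivation.leibniz_pow, der_pinv ξ hα,
      Nat.add_sub_cancel, ← Nat.cast_smul_eq_nsmul ℝ, smul_eq_mul, mul_smul_comm, smul_mul_assoc,
      smul_mul_assoc]
    congr 2
    ring

theorem der_frac (ξ : V →ₗ[ℝ] ℝ) {m : V →₀ ℕ} (hm : m.support ⊆ Δ) :
    der b Δ ξ (frac b Δ m) =
      ∑ α ∈ m.support, (m α * -ξ α) • frac b Δ (m + Finsupp.single α 1) := by
  rw [der_frac_eq_mul ξ m hm, Finsupp.sum, Finset.sum_mul]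
  refine Finset.sum_congr rfl fun α _ => ?_
  rw [frac_add, frac_single, pow_one, smul_smul, smul_mul_assoc, mul_comm (pinv b Δ α)]

end Directional

/-! ### The sum `G_Δ + NG_Δ` is direct. -/

section Independence

variable {V : Type*} [AddCommGroup V] [Module ℝ V] {r : ℕ} {b : Module.Basis (Fin r) ℝ V}
  {Δ : Finset V}

theorem der_mem_G (ξ : V →ₗ[ℝ] ℝ) {x : R b Δ} (hx : x ∈ G b Δ) : der b Δ ξ x ∈ G b Δ := by
  classical
  refine G_induction (p := fun x => der b Δ ξ x ∈ G b Δ) ?_ ?_ ?_ ?_ hx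
  · rw [map_zero]
    exact Submodule.zero_mem _
  · intro x y hx hy
    rw [map_add]
    exact Submodule.add_mem _ hx hy
  · intro c x hx
    rw [Derivation.map_smul]
    exact Submodule.smul_mem _ _ hx
  · intro m hm
    rw [mem_bases] at hm
    rw [der_frac ξ hm.1]
    refine Submodule.sum_mem _ fun α hα => Submodule.smul_mem _ _ ?_
    have hsupp : (m + Finsupp.single α 1).support = m.support := by
      rw [support_add_single, Finset.insert_eq_of_mem hα]
    exact frac_mem_G (hsupp ▸ hm.1) (hsupp ▸ hm.2.2)

/-- The denominators are constant along ξ, so the derivative acts on the numerator alone, where it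
is locally nilpotent. -/
theorem exists_iterate_der_mul_frac_eq_zero {m : V →₀ ℕ} (hm : m.support ⊆ Δ) {ξ : V →ₗ[ℝ] ℝ}
    (hξ : ∀ α ∈ m.support, ξ α = 0) (ψ : MvPolynomial (Fin r) ℝ) :
    ∃ N, (der b Δ ξ)^[N] (algebraMap _ (R b Δ) ψ * frac b Δ m) = 0 := by
  have h0 : der b Δ ξ (frac b Δ m) = 0 := by
    rw [der_frac ξ hm]
    refine Finset.sum_eq_zero fun α hα => ?_
    rw [hξ α hα, neg_zero, mul_zero, zero_smul]
  have h1 : ∀ N, (der b Δ ξ)^[N] (algebraMap _ (R b Δ) ψ * frac b Δ m) =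
      algebraMap _ (R b Δ) ((polyDer b ξ)^[N] ψ) * frac b Δ m := by
    intro N
    induction N with
    | zero => rfl
    | succ N ih =>
      rw [Function.iterate_succ_apply', ih, Derivation.leibniz, h0, smul_zero, zero_add,
        smul_eq_mul, der_algebraMap, mul_comm, Function.iterate_succ_apply']
  obtain ⟨N, hN⟩ := exists_iterate_polyDer_eq_zero b ξ ψ
  exact ⟨N, by rw [h1, hN, map_zero, zero_mul]⟩

/-! The restriction of polynomial functions to a line. -/

variable (b) in
/-- The restriction of a polynomial function to the line `t ↦ y + t ξ`. -/
def onLine (y ξ : V →ₗ[ℝ] ℝ) : MvPolynomial (Fin r) ℝ →ₐ[ℝ] Polynomial ℝ :=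
  MvPolynomial.aeval fun i => Polynomial.C (y (b i)) + Polynomial.C (ξ (b i)) * Polynomial.X

theorem onLine_lin (y ξ : V →ₗ[ℝ] ℝ) (α : V) :
    onLine b y ξ (lin b α) = Polynomial.C (y α) + Polynomial.C (ξ α) * Polynomial.X := by
  rw [apply_eq_sum_repr (b := b) y α, apply_eq_sum_repr (b := b) ξ α, lin]
  simp only [onLine, map_sum, map_mul, MvPolynomial.aeval_X, MvPolynomial.aeval_C, mul_add,
    Finset.sum_add_distrib, Finset.sum_mul, mul_assoc, Polynomial.algebraMap_eq]

theorem onLine_polyDer (y ξ : V →ₗ[ℝ] ℝ) (p : MvPolynomial (Fin r) ℝ) :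
    onLine b y ξ (polyDer b ξ p) = Polynomial.derivative (onLine b y ξ p) := by
  induction p using MvPolynomial.induction_on with
  | C a => simp [polyDer, onLine]
  | add p q hp hq => simp only [map_add, hp, hq]
  | mul_X p i hp =>
    rw [Derivation.leibniz, map_add, smul_eq_mul, smul_eq_mul, map_mul, map_mul, hp, map_mul,
      Polynomial.derivative_mul, ← lin_basis b i, polyDer_lin, onLine_lin]
    simp [onLine]
    ring

theorem eval_zero_onLine (y ξ : V →ₗ[ℝ] ℝ) (p : MvPolynomial (Fin r) ℝ) :
    (onLine b y ξ p).eval 0 = MvPolynomial.eval (fun i => y (b i)) p := by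
  induction p using MvPolynomial.induction_on with
  | C a => simp [onLine]
  | add p q hp hq => simp only [map_add, Polynomial.eval_add, hp, hq]
  | mul_X p i hp =>
    rw [map_mul, Polynomial.eval_mul, hp, map_mul]
    simp [onLine]

theorem onLine_den_ne_zero {y : V →ₗ[ℝ] ℝ} (hy : ∀ α ∈ Δ, y α ≠ 0) (ξ : V →ₗ[ℝ] ℝ) (n : Δ → ℕ) :
    onLine b y ξ (den b Δ n) ≠ 0 := by
  intro h
  have h1 := eval_zero_onLine (b := b) y ξ (den b Δ n : MvPolynomial (Fin r) ℝ)
  rw [h, Polynomial.eval_zero, den, map_prod] at h1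
  obtain ⟨α, -, h2⟩ := Finset.prod_eq_zero_iff.mp h1.symm
  rw [map_pow, ← eval_zero_onLine y ξ, onLine_lin] at h2
  have h3 := eq_zero_of_pow_eq_zero h2
  exact hy α α.2 (by simpa using h3)

/-- Elements of `G_Δ` tend to zero at infinity along lines: spanning denominators cannot all be
constant in the direction ξ. The degree inequality survives reduction to a common denominator,
because denominators do not vanish at the regular point `y`. -/
theorem exists_degree_lt_of_mem_G {y ξ : V →ₗ[ℝ] ℝ} (hy : ∀ α ∈ Δ, y α ≠ 0) (hξ : ξ ≠ 0)
    {x : R b Δ} (hx : x ∈ G b Δ) : ∃ (p : MvPolynomial (Fin r) ℝ) (n : Δ → ℕ),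
      x = Localization.mk p (den b Δ n) ∧
      (onLine b y ξ p).degree < (onLine b y ξ (den b Δ n)).degree := by
  refine G_induction (p := fun x => ∃ (p : MvPolynomial (Fin r) ℝ) (n : Δ → ℕ),
      x = Localization.mk p (den b Δ n) ∧
      (onLine b y ξ p).degree < (onLine b y ξ (den b Δ n)).degree) ?_ ?_ ?_ ?_ hx
  · refine ⟨0, 0, (Localization.mk_zero _).symm, ?_⟩
    rw [map_zero, Polynomial.degree_zero, bot_lt_iff_ne_bot, Ne, Polynomial.degree_eq_bot]
    exact onLine_den_ne_zero hy ξ _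
  · rintro _ _ ⟨p, n, rfl, h1⟩ ⟨q, m, rfl, h2⟩
    have hden : den b Δ n * den b Δ m = den b Δ (n + m) := Subtype.ext (by
      simp [den, pow_add, Finset.prod_mul_distrib])
    refine ⟨_, n + m, by rw [Localization.add_mk, hden], ?_⟩
    rw [← hden, Submonoid.coe_mul, map_add, map_mul, map_mul, map_mul]
    refine (Polynomial.degree_add_le _ _).trans_lt (max_lt ?_ ?_)
    · rw [Polynomial.degree_mul, Polynomial.degree_mul]
      have : (onLine b y ξ (den b Δ n)).degree ≠ ⊥ :=
        fun h => onLine_den_ne_zero hy ξ n (Polynomial.degree_eq_bot.mp h)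
      exact WithBot.add_lt_add_left this h2
    · rw [Polynomial.degree_mul, Polynomial.degree_mul, add_comm]
      have : (onLine b y ξ (den b Δ m)).degree ≠ ⊥ :=
        fun h => onLine_den_ne_zero hy ξ m (Polynomial.degree_eq_bot.mp h)
      exact WithBot.add_lt_add_right this h1
  · rintro c _ ⟨p, n, rfl, h1⟩
    refine ⟨c • p, n, by rw [Localization.smul_mk], ?_⟩
    rw [map_smul]
    exact (Polynomial.degree_smul_le _ _).trans_lt h1
  · intro m hm
    rw [mem_bases] at hm
    refine ⟨1, fun α => m α, by rw [mk_den 1 hm.1, map_one, one_mul], ?_⟩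
    obtain ⟨α, hα, hξα⟩ : ∃ α ∈ m.support, ξ α ≠ 0 := by
      by_contra! hcon
      refine hξ (LinearMap.ext_on hm.2.2 fun α hα => ?_)
      rw [hcon α hα, LinearMap.zero_apply]
    have hne := onLine_den_ne_zero (b := b) hy ξ fun β => m β
    rw [den, map_prod] at hne
    rw [map_one, Polynomial.degree_one, ← Polynomial.natDegree_pos_iff_degree_pos, den, map_prod,
      Polynomial.natDegree_prod _ _ (Finset.prod_ne_zero_iff.mp hne)]
    refine Finset.sum_pos' (fun _ _ => Nat.zero_le _) ⟨⟨α, hm.1 hα⟩, Finset.mem_univ _, ?_⟩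
    rw [map_pow, Polynomial.natDegree_pow, onLine_lin, add_comm, Polynomial.natDegree_linear hξα,
      mul_one]
    exact Nat.pos_of_ne_zero (Finsupp.mem_support_iff.mp hα)

theorem algebraMap_injective (h0 : (0 : V) ∉ Δ) :
    Function.Injective (algebraMap (MvPolynomial (Fin r) ℝ) (R b Δ)) := by
  refine IsLocalization.injective (M := denoms b Δ) _ fun s hs => ?_
  rw [mem_nonZeroDivisors_iff_ne_zero]
  obtain ⟨n, rfl⟩ := exists_den b Δ hs
  exact Finset.prod_ne_zero_iff.mpr fun α _ => pow_ne_zero _ (lin_ne_zero b fun h => h0 (h ▸ α.2))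

theorem eval_lin (y : V →ₗ[ℝ] ℝ) (α : V) :
    MvPolynomial.eval (fun i => y (b i)) (lin b α) = y α := by
  rw [apply_eq_sum_repr (b := b) y α, lin]
  simp

theorem eq_zero_of_eval_eq_zero (h0 : (0 : V) ∉ Δ) {p : MvPolynomial (Fin r) ℝ}
    (hp : ∀ y : V →ₗ[ℝ] ℝ, (∀ α ∈ Δ, y α ≠ 0) → MvPolynomial.eval (fun i => y (b i)) p = 0) :
    p = 0 := by
  -- The extra factor vanishes at the non-regular points, where nothing is known about `p`.
  have h1 : p * ∏ α ∈ Δ, lin b α = 0 := by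
    refine MvPolynomial.funext fun x => ?_
    obtain ⟨y, hy⟩ : ∃ y : V →ₗ[ℝ] ℝ, (fun i => y (b i)) = x :=
      ⟨b.constr ℝ x, funext fun i => b.constr_basis ℝ x i⟩
    subst hy
    rw [map_mul, map_prod, map_zero]
    by_cases hreg : ∀ α ∈ Δ, y α ≠ 0
    · rw [hp y hreg, zero_mul]
    · push Not at hreg
      obtain ⟨α, hα, hyα⟩ := hreg
      rw [Finset.prod_eq_zero hα (by rw [eval_lin, hyα]), mul_zero]
  exact (mul_eq_zero.mp h1).resolve_right
    (Finset.prod_ne_zero_iff.mpr fun α hα => lin_ne_zero b fun h => h0 (h ▸ hα))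

/-- On each line in direction ξ through a regular point `y`, the fraction is constant and tends to
zero, so its value at `y` is zero; a numerator vanishing at all regular points is zero. -/
theorem eq_zero_of_der_eq_zero (h0 : (0 : V) ∉ Δ) {ξ : V →ₗ[ℝ] ℝ} (hξ : ξ ≠ 0)
    {x : R b Δ} (hx : x ∈ G b Δ) (hder : der b Δ ξ x = 0) : x = 0 := by
  obtain ⟨P, N, hN, hxP⟩ := exists_eq_mul_frac x
  suffices hP : P = 0 by rw [hxP, hP, map_zero, zero_mul]
  refine eq_zero_of_eval_eq_zero (b := b) h0 fun y hy => ?_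
  obtain ⟨p, n, hxp, hdeg⟩ := exists_degree_lt_of_mem_G hy hξ hx
  set q : MvPolynomial (Fin r) ℝ := (den b Δ n : MvPolynomial (Fin r) ℝ) with hq
  have hxq : x * algebraMap _ (R b Δ) q = algebraMap _ (R b Δ) p := by
    rw [hxp, Localization.mk_eq_mk', hq, IsLocalization.mk'_spec]
  have h1 := congrArg (der b Δ ξ) hxq
  rw [Derivation.leibniz, hder, smul_zero, add_zero, smul_eq_mul, der_algebraMap,
    der_algebraMap] at h1
  have h2 : p * polyDer b ξ q = polyDer b ξ p * q := by
    apply algebraMap_injective (b := b) h0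
    rw [map_mul, map_mul, ← h1, ← hxq]
    ring
  have h3 : onLine b y ξ p = 0 := by
    refine polynomial_eq_zero_of_wronskian hdeg ?_
    rw [← onLine_polyDer, ← onLine_polyDer, ← map_mul, ← map_mul, h2]
  have h4 := eval_zero_onLine (b := b) y ξ p
  rw [h3, Polynomial.eval_zero] at h4
  -- The representation `p / q` depends on `y`, whereas `P` must be fixed to conclude;
  -- cross-multiplying transfers the vanishing at `y` from `p` to `P`.
  have h5 : P * q = p * (den b Δ fun α => N α : MvPolynomial (Fin r) ℝ) := by
    rw [← mk_den P hN] at hxP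
    apply algebraMap_injective (b := b) h0
    rw [map_mul, map_mul, ← hxq, hxP, Localization.mk_eq_mk', mul_assoc, mul_comm (algebraMap _ _ q),
      ← mul_assoc, IsLocalization.mk'_spec]
  have h6 := congrArg (MvPolynomial.eval fun i => y (b i)) h5
  rw [map_mul, map_mul, ← h4, zero_mul] at h6
  refine (mul_eq_zero.mp h6).resolve_right ?_
  rw [hq, den, map_prod]
  exact Finset.prod_ne_zero_iff.mpr fun α _ => by
    rw [map_pow, eval_lin]
    exact pow_ne_zero _ (hy α α.2)

variable (b Δ) in
/-- The monoid of differential operators generated by the directional derivatives. -/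
def derMonoid : Submonoid (Module.End ℝ (R b Δ)) :=
  Submonoid.closure {D | ∃ ξ : V →ₗ[ℝ] ℝ, ξ ≠ 0 ∧ D = (der b Δ ξ : R b Δ →ₗ[ℝ] R b Δ)}

theorem derMonoid_comm {D D' : Module.End ℝ (R b Δ)} (hD : D ∈ derMonoid b Δ)
    (hD' : D' ∈ derMonoid b Δ) : D * D' = D' * D := by
  refine Submonoid.closure_induction₂ (motive := fun x y _ _ => x * y = y * x) ?_ ?_ ?_ ?_ ?_ hD hD'
  · rintro _ _ ⟨ξ, -, rfl⟩ ⟨η, -, rfl⟩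
    exact LinearMap.ext fun x => der_comm ξ η x
  · intro x _
    rw [one_mul, mul_one]
  · intro x _
    rw [one_mul, mul_one]
  · intro x y z _ _ _ hxz hyz
    rw [mul_assoc, hyz, ← mul_assoc, hxz, mul_assoc]
  · intro x y z _ _ _ hzx hzy
    rw [← mul_assoc, hzx, mul_assoc, hzy, mul_assoc]

/-- A non-generating set of denominators lies in the kernel of some `ξ ≠ 0`. For sums, the product
of the two operators works because they commute. -/
theorem exists_derMonoid_eq_zero {x : R b Δ} (hx : x ∈ NG b Δ) : ∃ D ∈ derMonoid b Δ, D x = 0 := by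
  refine NG_induction (p := fun x => ∃ D ∈ derMonoid b Δ, D x = 0)
    ⟨1, Submonoid.one_mem _, map_zero _⟩ ?_ ?_ ?_ hx
  · rintro x y ⟨D, hD, hx⟩ ⟨D', hD', hy⟩
    refine ⟨D * D', Submonoid.mul_mem _ hD hD', ?_⟩
    rw [map_add, Module.End.mul_apply D D' y, hy, map_zero, add_zero, derMonoid_comm hD hD',
      Module.End.mul_apply, hx, map_zero]
  · rintro c x ⟨D, hD, hx⟩
    exact ⟨D, hD, by rw [map_smul, hx, smul_zero]⟩
  · intro m hm hspan ψ
    obtain ⟨ξ, hξ, hker⟩ := Submodule.exists_le_ker_of_lt_top _ (lt_top_iff_ne_top.mpr hspan)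
    obtain ⟨N, hN⟩ := exists_iterate_der_mul_frac_eq_zero (b := b) hm
      (fun α hα => LinearMap.mem_ker.mp (hker (Submodule.subset_span hα))) ψ
    have hmem : ((der b Δ ξ : R b Δ →ₗ[ℝ] R b Δ) : Module.End ℝ (R b Δ)) ∈ derMonoid b Δ :=
      Submonoid.subset_closure ⟨ξ, hξ, rfl⟩
    refine ⟨_, Submonoid.pow_mem _ hmem N, ?_⟩
    rw [Module.End.pow_apply]
    exact hN

/-- Stability of `G_Δ` is proved together with injectivity, since composing operators needs both. -/
theorem derMonoid_injective (h0 : (0 : V) ∉ Δ) {D : Module.End ℝ (R b Δ)}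
    (hD : D ∈ derMonoid b Δ) : ∀ x ∈ G b Δ, D x ∈ G b Δ ∧ (D x = 0 → x = 0) := by
  induction hD using Submonoid.closure_induction with
  | mem D hD =>
    obtain ⟨ξ, hξ, rfl⟩ := hD
    exact fun x hx => ⟨der_mem_G ξ hx, eq_zero_of_der_eq_zero h0 hξ hx⟩
  | one => exact fun x hx => ⟨hx, id⟩
  | mul D D' _ _ h1 h2 =>
    intro x hx
    obtain ⟨h3, h4⟩ := h2 x hx
    obtain ⟨h5, h6⟩ := h1 _ h3
    exact ⟨h5, fun h => h4 (h6 h)⟩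

/-- `R_Δ` is the direct sum of `G_Δ` and `NG_Δ`. -/
theorem isCompl_G_NG (h0 : (0 : V) ∉ Δ) : IsCompl (G b Δ) (NG b Δ) := by
  refine ⟨?_, codisjoint_iff.mpr G_sup_NG⟩
  rw [Submodule.disjoint_def]
  intro x hG hNG
  obtain ⟨D, hD, hx⟩ := exists_derMonoid_eq_zero hNG
  exact (derMonoid_injective h0 hD x hG).2 hx

end Independence

/-! ### The homogeneous parts of `e^h`. -/

section Exponential

open scoped Nat

/-- The multinomial formula, with divided powers. -/
theorem inv_factorial_smul_sum_pow {ι A : Type*} [DecidableEq ι] [CommRing A] [Algebra ℝ A]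
    (s : Finset ι) (a : ι → A) (j : ℕ) :
    ((j ! : ℝ)⁻¹) • (∑ i ∈ s, a i) ^ j =
      ∑ k ∈ s.piAntidiag j, (∏ i ∈ s, ((k i)! : ℝ)⁻¹) • ∏ i ∈ s, a i ^ k i := by
  rw [Finset.sum_pow_eq_sum_piAntidiag, Finset.smul_sum]
  refine Finset.sum_congr rfl fun k hk => ?_
  rw [Finset.mem_piAntidiag] at hk
  rw [← nsmul_eq_mul, ← Nat.cast_smul_eq_nsmul ℝ, smul_smul]
  congr 1
  have h1 := Nat.multinomial_spec s k
  rw [hk.1] at h1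
  have h2 : ((∏ i ∈ s, (k i)! : ℕ) : ℝ) ≠ 0 :=
    Nat.cast_ne_zero.mpr (Finset.prod_ne_zero_iff.mpr fun i _ => Nat.factorial_ne_zero _)
  have h3 : (Nat.multinomial s k : ℝ) ≠ 0 := Nat.cast_ne_zero.mpr (Nat.multinomial_pos s k).ne'
  rw [← h1, Nat.cast_mul, Finset.prod_inv_distrib]
  push_cast at h2 ⊢
  field_simp

variable {V : Type*} [AddCommGroup V] [Module ℝ V] {r : ℕ} (b : Module.Basis (Fin r) ℝ V)

theorem coeff_inv_factorial_smul_lin_pow (h : V) (j : ℕ) (d : Fin r →₀ ℕ) :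
    MvPolynomial.coeff d (((j ! : ℝ)⁻¹) • lin b h ^ j) =
      if d.degree = j then MvPowerSeries.coeff d (expSeries b h) else 0 := by
  classical
  rw [lin, inv_factorial_smul_sum_pow, MvPolynomial.coeff_sum]
  have h1 : ∀ k : Fin r → ℕ, MvPolynomial.coeff d ((∏ i, ((k i)! : ℝ)⁻¹) •
      ∏ i, (MvPolynomial.C (b.repr h i) * MvPolynomial.X i) ^ k i) =
      if k = d then MvPowerSeries.coeff d (expSeries b h) else 0 := by
    intro k
    simp_rw [mul_pow]
    rw [Finset.prod_mul_distrib, MvPolynomial.coeff_smul]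
    simp_rw [← map_pow]
    rw [← map_prod, MvPolynomial.coeff_C_mul, MvPolynomial.coeff_prod_X_pow]
    have h2 : d = Finsupp.indicator Finset.univ (fun i _ => k i) ↔ k = d := by
      rw [Finsupp.ext_iff, funext_iff]
      simp [eq_comm]
    rw [if_congr h2 rfl rfl]
    split_ifs with hk
    · subst hk
      change _ = ∏ i, b.repr h i ^ d i / (d i)!
      rw [mul_one, smul_eq_mul, ← Finset.prod_mul_distrib]
      exact Finset.prod_congr rfl fun i _ => by rw [div_eq_inv_mul]
    · simp
  simp_rw [h1]
  rw [Finset.sum_ite_eq']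
  refine if_congr ?_ rfl rfl
  rw [Finset.mem_piAntidiag, Finsupp.degree_eq_sum]
  simp

theorem truncTotal_expSeries (h : V) (N : ℕ) : MvPowerSeries.truncTotal N (expSeries b h) =
    ∑ j ∈ Finset.range N, ((j ! : ℝ)⁻¹) • lin b h ^ j := by
  classical
  ext d
  rw [MvPolynomial.coeff_sum, MvPowerSeries.coeff_truncTotal_eq_ite]
  simp_rw [coeff_inv_factorial_smul_lin_pow]
  rw [Finset.sum_ite_eq]
  simp

end Exponential

/-! ### Total degrees and the Taylor expansion. -/

section Degree

variable {V : Type*} {Δ : Finset V}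

theorem sum_exponents {m : V →₀ ℕ} (hm : m.support ⊆ Δ) :
    ∑ α : Δ, ((m (α : V) : ℕ) : ℤ) = (m.degree : ℤ) := by
  rw [Finset.sum_coe_sort Δ (fun v => (m v : ℤ)), Finsupp.degree_apply, Nat.cast_sum]
  exact (Finset.sum_subset hm fun v _ hv => by simpa using hv).symm

end Degree

section Taylor

variable {V : Type*} [AddCommGroup V] [Module ℝ V] {r : ℕ} {b : Module.Basis (Fin r) ℝ V}
  {Δ : Finset V}

theorem toHat_mk (p : MvPolynomial (Fin r) ℝ) (n : Δ → ℕ) :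
    toHat b Δ (Localization.mk p (den b Δ n)) =
      Localization.mk (p : MvPowerSeries (Fin r) ℝ) (denHat b Δ n) := by
  rw [Localization.mk_eq_mk', Localization.mk_eq_mk']
  exact IsLocalization.map_mk' (T := denomsHat b Δ) (Q := RHat b Δ)
    (show denoms b Δ ≤ (denomsHat b Δ).comap _ from Submonoid.le_comap_map (denoms b Δ))
    p (den b Δ n)

theorem toHat_smul (c : ℝ) (x : R b Δ) : toHat b Δ (c • x) = c • toHat b Δ x := by
  obtain ⟨ψ, m, hm, rfl⟩ := exists_eq_mul_frac x
  rw [← mk_den ψ hm, Localization.smul_mk, toHat_mk, toHat_mk, Localization.smul_mk]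
  congr 1

theorem denHat_add (n m : Δ → ℕ) : denHat b Δ n * denHat b Δ m = denHat b Δ (n + m) :=
  Subtype.ext (by simp [denHat, den, pow_add, Finset.prod_mul_distrib])

theorem den_add (n m : Δ → ℕ) : den b Δ n * den b Δ m = den b Δ (n + m) :=
  Subtype.ext (by simp [den, pow_add, Finset.prod_mul_distrib])

theorem exists_eq_mk (φ : RHat b Δ) : ∃ (f : MvPowerSeries (Fin r) ℝ) (n : Δ → ℕ),
    φ = Localization.mk f (denHat b Δ n) := by
  obtain ⟨p, hp⟩ := exists_rep b Δ φ
  exact ⟨p.2, p.1, hp⟩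

theorem taylor_add (h0 : (0 : V) ∉ Δ) (K : ℤ) (φ ψ : RHat b Δ) :
    taylor b Δ K (φ + ψ) = taylor b Δ K φ + taylor b Δ K ψ := by
  obtain ⟨f, n, rfl⟩ := exists_eq_mk φ
  obtain ⟨g, m, rfl⟩ := exists_eq_mk ψ
  rw [Localization.add_mk, denHat_add, taylor_mk b Δ h0, taylor_mk b Δ h0, taylor_mk b Δ h0,
    Localization.add_mk, den_add, map_add]
  have h1 := truncTotal_mul (den_isHomogeneous b Δ n) (K + ∑ α, (m α : ℤ) + 1) g
  have h2 := truncTotal_mul (den_isHomogeneous b Δ m) (K + ∑ α, (n α : ℤ) + 1) f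
  rw [← h1, ← h2]
  have e1 : K + ∑ α, ((n + m) α : ℤ) + 1 = K + ∑ α, (m α : ℤ) + 1 + ((∑ α, n α : ℕ) : ℤ) := by
    push_cast [Pi.add_apply, Finset.sum_add_distrib]
    ring
  have e2 : K + ∑ α, ((n + m) α : ℤ) + 1 = K + ∑ α, (n α : ℤ) + 1 + ((∑ α, m α : ℕ) : ℤ) := by
    push_cast [Pi.add_apply, Finset.sum_add_distrib]
    ring
  rw [← e1, ← e2]
  rfl

theorem taylor_smul (h0 : (0 : V) ∉ Δ) (K : ℤ) (c : ℝ) (φ : RHat b Δ) :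
    taylor b Δ K (c • φ) = c • taylor b Δ K φ := by
  obtain ⟨f, n, rfl⟩ := exists_eq_mk φ
  rw [Localization.smul_mk, taylor_mk b Δ h0, taylor_mk b Δ h0, Localization.smul_mk, map_smul]

theorem algebraMap_mul_mk (F f : MvPowerSeries (Fin r) ℝ) (n : Δ → ℕ) :
    algebraMap _ (RHat b Δ) F * Localization.mk f (denHat b Δ n) =
      Localization.mk (F * f) (denHat b Δ n) := by
  rw [← Localization.mk_one_eq_algebraMap, Localization.mk_mul, one_mul]

theorem taylor_mul_toHat (h0 : (0 : V) ∉ Δ) (K : ℤ) (F : MvPowerSeries (Fin r) ℝ)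
    (ψ : MvPolynomial (Fin r) ℝ) {m : V →₀ ℕ} (hm : m.support ⊆ Δ) :
    taylor b Δ K (algebraMap _ _ F * toHat b Δ (algebraMap _ (R b Δ) ψ * frac b Δ m)) =
      algebraMap _ (R b Δ) (MvPowerSeries.truncTotal (K + m.degree + 1).toNat
        (F * (ψ : MvPowerSeries (Fin r) ℝ))) * frac b Δ m := by
  rw [← mk_den ψ hm, toHat_mk, algebraMap_mul_mk, taylor_mk b Δ h0, sum_exponents hm, mk_den _ hm]

/-- A power series has no terms of negative degree, so the part of φ of degree above `K` contributes
nothing up to degree `K`. -/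
theorem taylor_mul_sub (h0 : (0 : V) ∉ Δ) (K : ℤ) (F : MvPowerSeries (Fin r) ℝ) (φ : RHat b Δ) :
    taylor b Δ K (algebraMap _ _ F * φ) =
      taylor b Δ K (algebraMap _ _ F * toHat b Δ (taylor b Δ K φ)) := by
  classical
  obtain ⟨f, n, rfl⟩ := exists_eq_mk φ
  rw [taylor_mk b Δ h0, toHat_mk, algebraMap_mul_mk, algebraMap_mul_mk, taylor_mk b Δ h0,
    taylor_mk b Δ h0]
  congr 1
  set N := (K + ∑ α, (n α : ℤ) + 1).toNat
  ext d
  rw [MvPowerSeries.coeff_truncTotal_eq_ite, MvPowerSeries.coeff_truncTotal_eq_ite]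
  split_ifs with hd
  · rw [MvPowerSeries.coeff_mul, MvPowerSeries.coeff_mul]
    refine Finset.sum_congr rfl fun p hp => ?_
    have hp2 : Finsupp.degree p.2 < N := by
      have := congrArg Finsupp.degree (Finset.HasAntidiagonal.mem_antidiagonal.mp hp)
      rw [map_add] at this
      omega
    rw [MvPolynomial.coeff_coe, MvPowerSeries.coeff_truncTotal_eq_ite, if_pos hp2]
  · rfl

end Taylor

theorem card_support_le_degree {V : Type*} (m : V →₀ ℕ) : m.support.card ≤ m.degree := by
  rw [Finsupp.degree_apply, Finset.card_eq_sum_ones]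
  exact Finset.sum_le_sum fun α hα => Nat.one_le_iff_ne_zero.mpr (Finsupp.mem_support_iff.mp hα)

/-! ### The residue of `e^h` times a fraction. -/

section Residue

variable {V : Type*} [AddCommGroup V] [Module ℝ V] {r : ℕ} {b : Module.Basis (Fin r) ℝ V}
  {Δ : Finset V}

theorem princ_eq (h0 : (0 : V) ∉ Δ) (φ : RHat b Δ) :
    princ b Δ φ = (G b Δ).projection (NG b Δ) (isCompl_G_NG h0) (taylor b Δ (-(r : ℤ)) φ) :=
  dif_pos (isCompl_G_NG h0)

theorem princ_mem_G (h0 : (0 : V) ∉ Δ) (φ : RHat b Δ) : princ b Δ φ ∈ G b Δ := by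
  rw [princ_eq h0]
  exact Submodule.projection_apply_mem _ _

variable (b Δ) in
/-- `Res_Δ`, as a function of the Taylor expansion. -/
def gradedProj (h0 : (0 : V) ∉ Δ) : R b Δ →ₗ[ℝ] R b Δ where
  toFun x := gradedPart b Δ (-(r : ℤ))
    (toHat b Δ ((G b Δ).projection (NG b Δ) (isCompl_G_NG h0) x))
  map_add' x y := by
    rw [map_add, map_add, gradedPart, gradedPart, gradedPart, taylor_add h0, taylor_add h0]
    ring
  map_smul' c x := by
    rw [map_smul, toHat_smul, gradedPart, gradedPart, taylor_smul h0, taylor_smul h0,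
      RingHom.id_apply, smul_sub]

theorem res_eq_gradedProj (h0 : (0 : V) ∉ Δ) (φ : RHat b Δ) :
    res b Δ φ = gradedProj b Δ h0 (taylor b Δ (-(r : ℤ)) φ) := by
  rw [res, princ_eq h0]
  rfl

theorem gradedProj_of_mem_NG (h0 : (0 : V) ∉ Δ) {x : R b Δ} (hx : x ∈ NG b Δ) :
    gradedProj b Δ h0 x = 0 := by
  have h1 : gradedProj b Δ h0 x = gradedPart b Δ (-(r : ℤ))
      (toHat b Δ ((G b Δ).projection (NG b Δ) (isCompl_G_NG h0) x)) := rfl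
  have h2 : gradedProj b Δ h0 0 = gradedPart b Δ (-(r : ℤ))
      (toHat b Δ ((G b Δ).projection (NG b Δ) (isCompl_G_NG h0) 0)) := rfl
  rw [map_zero, map_zero] at h2
  rw [h1, (Submodule.projection_apply_eq_zero_iff _).mpr hx, ← h2]

/-- The fraction is homogeneous of degree `-m.degree`, so it is kept entirely or dropped entirely.
-/
theorem taylor_toHat (h0 : (0 : V) ∉ Δ) (K : ℤ) {m : V →₀ ℕ} (hm : m.support ⊆ Δ) :
    taylor b Δ K (toHat b Δ (frac b Δ m)) = if 0 ≤ K + m.degree then frac b Δ m else 0 := by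
  have h1 := taylor_mul_toHat (b := b) h0 K 1 1 hm
  rw [map_one, one_mul, map_one, one_mul, MvPolynomial.coe_one, one_mul] at h1
  rw [h1]
  split_ifs with hK
  · rw [MvPowerSeries.truncTotal_one (by omega), map_one, one_mul]
  · have : (K + m.degree + 1).toNat = 0 := by omega
    rw [this]
    have h2 : MvPowerSeries.truncTotal 0 (1 : MvPowerSeries (Fin r) ℝ) = 0 := by
      ext d
      simp [MvPowerSeries.coeff_truncTotal_eq_ite]
    rw [h2, map_zero, zero_mul]

theorem card_of_mem_bases (b : Module.Basis (Fin r) ℝ V) {σ : Finset V} (hσ : σ ∈ bases Δ) :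
    σ.card = r := by
  rw [mem_bases] at hσ
  have h1 := Module.finrank_eq_card_basis
    (Module.Basis.mk (v := fun α : σ => (α : V)) hσ.2.1 (by
      rw [Subtype.range_coe_subtype]
      exact hσ.2.2.ge))
  have h2 := Module.finrank_eq_card_basis b
  rw [Fintype.card_coe] at h1
  rw [Fintype.card_fin] at h2
  omega

theorem gradedProj_frac (h0 : (0 : V) ∉ Δ) {m : V →₀ ℕ} (hm : m.support ∈ bases Δ) :
    gradedProj b Δ h0 (frac b Δ m) = if m.degree = r then frac b Δ m else 0 := by
  have h1 : gradedProj b Δ h0 (frac b Δ m) = gradedPart b Δ (-(r : ℤ))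
      (toHat b Δ ((G b Δ).projection (NG b Δ) (isCompl_G_NG h0) (frac b Δ m))) := rfl
  have hcard := card_of_mem_bases b hm
  have hdeg := card_support_le_degree m
  have hm' := mem_bases.mp hm
  rw [h1, Submodule.projection_apply_of_mem_left _ (frac_mem_G hm'.1 hm'.2.2), gradedPart,
    taylor_toHat h0 _ hm'.1, taylor_toHat h0 _ hm'.1, if_pos (by omega)]
  by_cases h : m.degree = r
  · rw [if_pos h, if_neg (by omega), sub_zero]
  · rw [if_neg h, if_pos (by omega), sub_self]

/-- A basis has `r` elements, so `G_Δ` lives in degrees at most `-r` and truncation loses nothing.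
This allows the residue to be fed back into the inverse Laplace transform. -/
theorem princ_toHat (h0 : (0 : V) ∉ Δ) {x : R b Δ} (hx : x ∈ G b Δ) :
    princ b Δ (toHat b Δ x) = x := by
  refine G_induction (p := fun x => princ b Δ (toHat b Δ x) = x) ?_ ?_ ?_ ?_ hx
  · have h1 := taylor_smul (b := b) h0 (-(r : ℤ)) 0 0
    rw [zero_smul, zero_smul] at h1
    rw [map_zero, princ_eq h0, h1, map_zero]
  · intro x y hx hy
    rw [princ_eq h0] at hx hy ⊢
    rw [map_add, taylor_add h0, map_add, hx, hy]
  · intro c x hx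
    rw [princ_eq h0] at hx ⊢
    rw [toHat_smul, taylor_smul h0, map_smul, hx]
  · intro m hm
    have hcard := card_of_mem_bases b hm
    have hdeg := card_support_le_degree m
    have hm' := mem_bases.mp hm
    rw [princ_eq h0, taylor_toHat h0 _ hm'.1, if_pos (by omega),
      Submodule.projection_apply_of_mem_left _ (frac_mem_G hm'.1 hm'.2.2)]

theorem prod_lin_mul_frac {k m : V →₀ ℕ} (hm : m.support ⊆ Δ) (hk : k ≤ m) :
    algebraMap _ (R b Δ) (∏ α ∈ m.support, lin b α ^ k α) * frac b Δ m = frac b Δ (m - k) := by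
  have h1 : k.support ⊆ m.support := Finsupp.support_mono hk
  have h2 : algebraMap _ (R b Δ) (∏ α ∈ m.support, lin b α ^ k α) * frac b Δ k = 1 := by
    rw [frac, Finsupp.prod_of_support_subset k h1 _ (by simp), map_prod, ← Finset.prod_mul_distrib]
    refine Finset.prod_eq_one fun α hα => ?_
    rw [map_pow, ← mul_pow, ← linR_apply, linR_mul_pinv (hm hα), one_pow]
  conv_lhs => rw [← tsub_add_cancel_of_le hk, frac_add]
  rw [tsub_add_cancel_of_le hk, mul_left_comm, h2, mul_one]

/-- The numerator cancels α completely, and the independent denominators that remain cannot span. -/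
theorem mul_frac_mem_NG_of_dvd {m : V →₀ ℕ} (hm : m.support ⊆ Δ)
    (hli : LinearIndepOn ℝ id (m.support : Set V)) {α : V} (hα : α ∈ m.support)
    {ψ : MvPolynomial (Fin r) ℝ} (hψ : lin b α ^ m α ∣ ψ) :
    algebraMap _ (R b Δ) ψ * frac b Δ m ∈ NG b Δ := by
  classical
  obtain ⟨ψ, rfl⟩ := hψ
  have h1 : frac b Δ m = pinv b Δ α ^ m α * frac b Δ (m.erase α) := by
    rw [← frac_single, ← frac_add, Finsupp.single_add_erase]
  have h2 : algebraMap _ (R b Δ) (lin b α ^ m α * ψ) * frac b Δ m =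
      algebraMap _ (R b Δ) ψ * frac b Δ (m.erase α) := by
    have h3 : algebraMap _ (R b Δ) (lin b α ^ m α) * pinv b Δ α ^ m α = 1 := by
      rw [map_pow, ← mul_pow, ← linR_apply, linR_mul_pinv (hm hα), one_pow]
    calc _ = (algebraMap _ (R b Δ) (lin b α ^ m α) * pinv b Δ α ^ m α) *
          (algebraMap _ (R b Δ) ψ * frac b Δ (m.erase α)) := by
            rw [h1, map_mul]
            ring
      _ = _ := by rw [h3, one_mul]
  rw [h2]
  refine mul_frac_mem_NG ?_ ?_ ψ
  · rw [Finsupp.support_erase]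
    exact (Finset.erase_subset _ _).trans hm
  · intro htop
    rw [Finsupp.support_erase] at htop
    have h3 := hli.notMem_span (Finset.mem_coe.mpr hα)
    rw [Set.image_id, ← Finset.coe_erase, htop] at h3
    exact h3 Submodule.mem_top

theorem phi_eq_frac {σ : Finset V} (hσ : σ ⊆ Δ) :
    phi b Δ σ = frac b Δ (Finsupp.indicator σ fun _ _ => 1) := by
  classical
  have h1 : (Finsupp.indicator σ fun _ _ => (1 : ℕ)).support ⊆ Δ :=
    (Finsupp.support_indicator_subset _ _).trans hσ
  have h2 := mk_den (b := b) 1 h1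
  rw [map_one, one_mul] at h2
  rw [← h2, phi]
  congr 2

open scoped Nat in
-- Expand `e^h` into products of powers `k α` of the basis elements. If some `k α ≥ m α`, a pole
-- disappears and the term is in `NG_Δ`. Otherwise the term is the fraction with exponents `m - k`,
-- all positive, and it has degree `-r` exactly when all of them are one. Only `k = m - 1` survives,
-- with coefficient the divided power of the coordinates.
theorem res_exp_mul_frac (h0 : (0 : V) ∉ Δ) {m : V →₀ ℕ} (hm : m.support ∈ bases Δ) {c : V → ℝ}
    {h : V} (hc : h = ∑ α ∈ m.support, c α • α) :
    res b Δ (expHat b Δ h * toHat b Δ (frac b Δ m)) =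
      (∏ α ∈ m.support, c α ^ (m α - 1) / (m α - 1)!) • phi b Δ m.support := by
  classical
  have hcard := card_of_mem_bases b hm
  have hdeg := card_support_le_degree m
  obtain ⟨hmΔ, hli, hspan⟩ := mem_bases.mp hm
  have hmpos : ∀ α ∈ m.support, 1 ≤ m α := fun α hα =>
    Nat.one_le_iff_ne_zero.mpr (Finsupp.mem_support_iff.mp hα)
  have hlin : lin b h = ∑ α ∈ m.support, MvPolynomial.C (c α) * lin b α := by
    have : ∀ x y : V, lin b (x + y) = lin b x + lin b y := fun x y => by
      simp [lin, add_mul, Finset.sum_add_distrib]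
    have h2 : ∀ (t : ℝ) (x : V), lin b (t • x) = MvPolynomial.C t * lin b x := fun t x => by
      simp [lin, Finset.mul_sum, mul_assoc]
    have h3 : lin b (0 : V) = 0 := by simp [lin]
    rw [hc]
    simp_rw [← h2]
    exact map_sum (AddMonoidHom.mk' (lin b) this) _ _
  have h1 := taylor_mul_toHat (b := b) h0 (-(r : ℤ)) (expSeries b h) 1 hmΔ
  rw [map_one, one_mul, MvPolynomial.coe_one, mul_one, truncTotal_expSeries] at h1
  rw [res_eq_gradedProj h0, expHat, h1]
  -- Truncation keeps the powers of `h` up to `m.degree - r`, the total degree of `m - 1`, so the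
  -- surviving term is just included.
  have hN : (-(r : ℤ) + m.degree + 1).toNat = (m.degree - r) + 1 := by omega
  have hdegm : m.degree = ∑ α ∈ m.support, m α := Finsupp.degree_apply m
  have hterm : ∀ k : V → ℕ,
      gradedProj b Δ h0 (algebraMap _ (R b Δ) (∏ α ∈ m.support, lin b α ^ k α) * frac b Δ m) =
        if ∀ α ∈ m.support, k α = m α - 1 then phi b Δ m.support else 0 := by
    intro k
    by_cases hlt : ∀ α ∈ m.support, k α < m α
    · set k' : V →₀ ℕ := Finsupp.indicator m.support fun α _ => k α with hk'
      have hk1 : ∀ α ∈ m.support, k' α = k α := fun α hα => Finsupp.indicator_of_mem hα _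
      have hk2 : ∀ α, α ∉ m.support → k' α = 0 := fun α hα => Finsupp.indicator_of_notMem hα _
      have hk3 : k' ≤ m := fun α => by
        by_cases hα : α ∈ m.support
        · exact hk1 α hα ▸ (hlt α hα).le
        · rw [hk2 α hα]; exact Nat.zero_le _
      have hsupp : (m - k').support = m.support := by
        refine Finset.Subset.antisymm Finsupp.support_tsub fun α hα => ?_
        have := hlt α hα
        rw [Finsupp.mem_support_iff, Finsupp.tsub_apply, hk1 α hα]
        omega
      rw [Finset.prod_congr rfl fun α hα => by rw [← hk1 α hα], prod_lin_mul_frac hmΔ hk3,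
        gradedProj_frac h0 (hsupp ▸ hm)]
      have hdeg' : (m - k').degree = ∑ α ∈ m.support, (m α - k α) := by
        rw [Finsupp.degree_apply, hsupp]
        exact Finset.sum_congr rfl fun α hα => by rw [Finsupp.tsub_apply, hk1 α hα]
      -- A sum of `r` positive integers is `r` exactly when they are all one.
      have hiff : (m - k').degree = r ↔ ∀ α ∈ m.support, k α = m α - 1 := by
        rw [hdeg', ← hcard, Finset.card_eq_sum_ones, eq_comm, Finset.sum_eq_sum_iff_of_le
          fun α hα => by have := hlt α hα; omega]
        refine forall₂_congr fun α hα => ?_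
        have := hlt α hα
        omega
      by_cases hall : ∀ α ∈ m.support, k α = m α - 1
      · rw [if_pos (hiff.mpr hall), if_pos hall, phi_eq_frac hmΔ]
        congr 1
        ext α
        by_cases hα : α ∈ m.support
        · have := hmpos α hα
          rw [Finsupp.tsub_apply, hk1 α hα, hall α hα, Finsupp.indicator_of_mem hα]
          omega
        · rw [Finsupp.tsub_apply, Finsupp.notMem_support_iff.mp hα, hk2 α hα,
            Finsupp.indicator_of_notMem hα, Nat.sub_zero]
      · rw [if_neg fun hr => hall (hiff.mp hr), if_neg hall]
    · push Not at hlt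
      obtain ⟨α, hα, hle⟩ := hlt
      rw [if_neg fun hall => by have := hall α hα; have := hmpos α hα; omega]
      exact gradedProj_of_mem_NG h0 (mul_frac_mem_NG_of_dvd hmΔ hli hα
        ((pow_dvd_pow _ hle).trans (Finset.dvd_prod_of_mem (fun α => lin b α ^ k α) hα)))
  have hpow : ∀ j : ℕ, gradedProj b Δ h0
      (algebraMap _ (R b Δ) (((j ! : ℝ)⁻¹) • lin b h ^ j) * frac b Δ m) =
      ∑ k ∈ m.support.piAntidiag j, ((∏ α ∈ m.support, ((k α)! : ℝ)⁻¹) *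
        ∏ α ∈ m.support, c α ^ k α) •
        if ∀ α ∈ m.support, k α = m α - 1 then phi b Δ m.support else 0 := by
    intro j
    rw [hlin, inv_factorial_smul_sum_pow, map_sum, Finset.sum_mul, map_sum]
    refine Finset.sum_congr rfl fun k _ => ?_
    simp_rw [mul_pow]
    rw [Finset.prod_mul_distrib]
    simp_rw [← map_pow]
    rw [← map_prod, MvPolynomial.smul_eq_C_mul, ← mul_assoc, ← MvPolynomial.C_mul,
      map_mul (algebraMap (MvPolynomial (Fin r) ℝ) (R b Δ)),
      mul_assoc, algebraMap_C_mul, map_smul, hterm]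
  have hsum : ∑ α ∈ m.support, (m α - 1) = m.degree - r := by
    rw [Finset.sum_tsub_distrib _ hmpos, ← hdegm, ← Finset.card_eq_sum_ones, hcard]
  rw [hN, map_sum, Finset.sum_mul, map_sum, Finset.sum_congr rfl fun j _ => hpow j,
    Finset.sum_eq_single (m.degree - r)]
  · set k₀ : V → ℕ := fun α => if α ∈ m.support then m α - 1 else 0 with hk₀
    have hk₀' : ∀ α ∈ m.support, k₀ α = m α - 1 := fun α hα => if_pos hα
    rw [Finset.sum_eq_single k₀]
    · rw [if_pos hk₀', ← Finset.prod_mul_distrib]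
      congr 1
      refine Finset.prod_congr rfl fun α hα => ?_
      rw [hk₀' α hα, div_eq_inv_mul]
    · intro k hk hne
      rw [Finset.mem_piAntidiag] at hk
      rw [if_neg, smul_zero]
      intro hall
      refine hne (funext fun α => ?_)
      by_cases hα : α ∈ m.support
      · rw [hall α hα, hk₀' α hα]
      · rw [hk₀]
        simp only [if_neg hα]
        by_contra h
        exact hα (hk.2 α h)
    · intro hk
      refine absurd (Finset.mem_piAntidiag.mpr ⟨?_, fun α h => ?_⟩) hk
      · exact (Finset.sum_congr rfl hk₀').trans hsum
      · by_contra hα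
        exact h (if_neg hα)
  · intro j _ hj
    refine Finset.sum_eq_zero fun k hk => ?_
    rw [Finset.mem_piAntidiag] at hk
    rw [if_neg, smul_zero]
    intro hall
    exact hj (hk.1.symm.trans ((Finset.sum_congr rfl hall).trans hsum))
  · intro h
    exact absurd (Finset.mem_range.mpr (Nat.lt_succ_self _)) h

/-- `Res_Δ (e^h φ)` depends only on the principal part of `φ`. -/
theorem res_exp_mul_eq (h0 : (0 : V) ∉ Δ) (φ : RHat b Δ) (h : V) :
    res b Δ (expHat b Δ h * φ) = res b Δ (expHat b Δ h * toHat b Δ (princ b Δ φ)) := by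
  -- Numerators in `NG_Δ` are arbitrary, so truncated multiplication by `e^h` preserves it.
  have hN : ∀ x ∈ NG b Δ, res b Δ (expHat b Δ h * toHat b Δ x) = 0 := by
    intro x hx
    rw [res_eq_gradedProj h0]
    refine gradedProj_of_mem_NG h0 ?_
    refine NG_induction (p := fun x => taylor b Δ (-(r : ℤ)) (expHat b Δ h * toHat b Δ x) ∈ NG b Δ)
      ?_ ?_ ?_ ?_ hx
    · have h1 := taylor_smul (b := b) h0 (-(r : ℤ)) 0 0
      rw [zero_smul, zero_smul] at h1
      rw [map_zero, mul_zero, h1]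
      exact Submodule.zero_mem _
    · intro x y hx hy
      rw [map_add, mul_add, taylor_add h0]
      exact Submodule.add_mem _ hx hy
    · intro c x hx
      rw [toHat_smul, mul_smul_comm, taylor_smul h0]
      exact Submodule.smul_mem _ _ hx
    · intro m hm hspan ψ
      rw [expHat, taylor_mul_toHat h0 _ _ _ hm]
      exact mul_frac_mem_NG hm hspan _
  have hadd : ∀ x y : R b Δ, res b Δ (expHat b Δ h * toHat b Δ (x + y)) =
      res b Δ (expHat b Δ h * toHat b Δ x) + res b Δ (expHat b Δ h * toHat b Δ y) := by
    intro x y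
    rw [map_add, mul_add, res_eq_gradedProj h0, taylor_add h0, map_add, ← res_eq_gradedProj h0,
      ← res_eq_gradedProj h0]
  -- By `taylor_mul_sub`, φ may be truncated at order `-r` before multiplying; the truncation then
  -- splits into its principal part and a term in `NG_Δ`.
  have h1 := Submodule.projection_add_projection_eq_self (isCompl_G_NG (b := b) h0)
    (taylor b Δ (-(r : ℤ)) φ)
  have h2 := hN _ (Submodule.projection_apply_mem (isCompl_G_NG (b := b) h0).symm
    (taylor b Δ (-(r : ℤ)) φ))
  rw [res_eq_gradedProj h0, expHat, taylor_mul_sub h0, ← res_eq_gradedProj h0, ← expHat, ← h1,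
    hadd, h2, add_zero, princ_eq h0]

end Residue

/-! ### Coordinates in a basis contained in `Δ`. -/

section BasisOf

variable {V : Type*} [AddCommGroup V] [Module ℝ V] {Δ : Finset V}

/-- The basis with elements `σ`. -/
def basisOf {σ : Finset V} (hσ : σ ∈ bases Δ) : Module.Basis σ ℝ V :=
  Module.Basis.mk (v := fun α : σ => (α : V)) (mem_bases.mp hσ).2.1 (by
    rw [Subtype.range_coe_subtype]
    exact (mem_bases.mp hσ).2.2.ge)

@[simp] theorem basisOf_apply {σ : Finset V} (hσ : σ ∈ bases Δ) (α : σ) :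
    basisOf hσ α = (α : V) :=
  Module.Basis.mk_apply _ _ α

theorem eq_sum_coord {σ : Finset V} (hσ : σ ∈ bases Δ) (h : V) :
    h = ∑ α : σ, (basisOf hσ).repr h α • (α : V) := by
  conv_lhs => rw [← (basisOf hσ).sum_repr h]
  simp

end BasisOf

/-! ### Making bases positive on δ. -/

section Flips

variable {V : Type*} [NormedAddCommGroup V] [NormedSpace ℝ V] {Δ : Finset V}
  {δ : Set (StrongDual ℝ V)}

theorem isOpen_dualReg (Δ : Finset V) : IsOpen (dualReg Δ) := by
  have : dualReg Δ = ⋂ α ∈ Δ, {y : StrongDual ℝ V | y α ≠ 0} := by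
    ext y
    simp [dualReg]
  rw [this]
  refine isOpen_biInter_finset fun α _ => ?_
  exact isOpen_ne_fun (by fun_prop) continuous_const

theorem IsDualChamber.isOpen (hδ : IsDualChamber Δ δ) : IsOpen δ := by
  obtain ⟨y, hy, rfl⟩ := hδ
  exact (isOpen_dualReg Δ).connectedComponentIn

theorem IsDualChamber.nonempty (hδ : IsDualChamber Δ δ) : δ.Nonempty := by
  obtain ⟨y, hy, rfl⟩ := hδ
  exact ⟨y, mem_connectedComponentIn hy⟩

theorem IsDualChamber.subset (hδ : IsDualChamber Δ δ) : δ ⊆ dualReg Δ := by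
  obtain ⟨y, hy, rfl⟩ := hδ
  exact connectedComponentIn_subset _ _

theorem pos_or_neg_of_isPreconnected {X : Type*} [TopologicalSpace X] {s : Set X}
    (hs : IsPreconnected s) {f : X → ℝ} (hf : ContinuousOn f s) (h0 : ∀ x ∈ s, f x ≠ 0) :
    (∀ x ∈ s, 0 < f x) ∨ ∀ x ∈ s, f x < 0 := by
  by_contra! hcon
  obtain ⟨⟨x, hx, hx0⟩, y, hy, hy0⟩ := hcon
  obtain ⟨z, hz, hz0⟩ := hs.intermediate_value hx hy hf ⟨hx0, hy0⟩
  exact h0 z hz hz0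

theorem IsDualChamber.pos_or_neg (hδ : IsDualChamber Δ δ) {α : V} (hα : α ∈ Δ) :
    (∀ y ∈ δ, 0 < y α) ∨ ∀ y ∈ δ, y α < 0 := by
  refine pos_or_neg_of_isPreconnected ?_ (f := fun y : StrongDual ℝ V => y α)
    (Continuous.continuousOn (by fun_prop)) fun y hy => hδ.subset hy α hα
  obtain ⟨y, hy, rfl⟩ := hδ
  exact isPreconnected_connectedComponentIn

open Classical in
/-- The sign of `α` on `δ`. -/
def flipSign (δ : Set (StrongDual ℝ V)) (α : V) : ℝˣ := if ∀ y ∈ δ, 0 < y α then 1 else -1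

theorem flip_eq_smul (α : V) : flip δ α = (flipSign δ α : ℝ) • α := by
  unfold flip flipSign
  split_ifs <;> simp

theorem flipSign_mul_self (α : V) : (flipSign δ α : ℝ) * flipSign δ α = 1 := by
  unfold flipSign
  split_ifs <;> simp

theorem abs_flipSign (α : V) : |(flipSign δ α : ℝ)| = 1 := by
  unfold flipSign
  split_ifs <;> simp

theorem sign_eq_prod (σ : Finset V) : sign δ σ = ∏ α ∈ σ, (flipSign δ α : ℝ) := by
  unfold sign flipSign
  refine Finset.prod_congr rfl fun α _ => ?_
  split_ifs <;> simp

theorem flip_mem (hneg : ∀ α ∈ Δ, -α ∈ Δ) {α : V} (hα : α ∈ Δ) : flip δ α ∈ Δ := by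
  unfold flip
  split_ifs
  · exact hα
  · exact hneg α hα

theorem IsDualChamber.flip_pos (hδ : IsDualChamber Δ δ) {α : V} (hα : α ∈ Δ)
    {y : StrongDual ℝ V} (hy : y ∈ δ) : 0 < y (flip δ α) := by
  unfold flip
  split_ifs with h
  · exact h y hy
  · have := ((hδ.pos_or_neg hα).resolve_left h) y hy
    rw [map_neg]
    linarith

theorem linearIndependent_flip {σ : Finset V} (hσ : LinearIndepOn ℝ id (σ : Set V)) :
    LinearIndependent ℝ fun α : σ => flip δ (α : V) := by
  have h1 : LinearIndependent ℝ fun α : σ => (α : V) := hσ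
  have h2 := h1.units_smul fun α : σ => flipSign δ (α : V)
  convert h2 using 1
  funext α
  rw [flip_eq_smul]
  rfl

theorem injOn_flip {σ : Finset V} (hσ : LinearIndepOn ℝ id (σ : Set V)) :
    Set.InjOn (flip δ) (σ : Set V) := fun α hα β hβ h =>
  congrArg Subtype.val ((linearIndependent_flip (δ := δ) hσ).injective
    (a₁ := (⟨α, hα⟩ : σ)) (a₂ := (⟨β, hβ⟩ : σ)) h)

theorem flipSet_mem_bases (hneg : ∀ α ∈ Δ, -α ∈ Δ) {σ : Finset V} (hσ : σ ∈ bases Δ) :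
    flipSet δ σ ∈ bases Δ := by
  classical
  obtain ⟨h1, h2, h3⟩ := mem_bases.mp hσ
  have hrange : ((flipSet δ σ : Finset V) : Set V) = Set.range fun α : σ => flip δ (α : V) := by
    ext v
    simp [flipSet]
  refine mem_bases.mpr ⟨?_, ?_, ?_⟩
  · intro v hv
    obtain ⟨α, hα, rfl⟩ := Finset.mem_image.mp (by simpa [flipSet] using hv)
    exact flip_mem hneg (h1 hα)
  · rw [hrange]
    exact (linearIndependent_flip h2).linearIndepOn_id
  · rw [eq_top_iff, ← h3, Submodule.span_le]
    intro α hα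
    have h4 : α = (flipSign δ α : ℝ) • flip δ α := by
      rw [flip_eq_smul, smul_smul, flipSign_mul_self, one_smul]
    rw [SetLike.mem_coe, h4]
    refine Submodule.smul_mem _ _ (Submodule.subset_span ?_)
    rw [hrange]
    exact ⟨⟨α, hα⟩, rfl⟩

theorem flipSet_pos (hδ : IsDualChamber Δ δ) {σ : Finset V} (hσ : σ ∈ bases Δ) :
    ∀ α ∈ flipSet δ σ, ∀ y ∈ δ, 0 < y α := by
  classical
  intro v hv y hy
  obtain ⟨α, hα, rfl⟩ := Finset.mem_image.mp (by simpa [flipSet] using hv)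
  exact hδ.flip_pos ((mem_bases.mp hσ).1 hα) hy

variable {r : ℕ} (b : Module.Basis (Fin r) ℝ V)

/-- Each sign occurs twice, once in front and once inside the inverses, and squares to one. No
injectivity of `flip` is needed here; it only enters when the support of the new exponent is
computed. -/
theorem frac_mapDomain_flip (m : V →₀ ℕ) :
    frac b Δ m = (∏ α ∈ m.support, (flipSign δ α : ℝ) ^ m α) •
      frac b Δ (m.mapDomain (flip δ)) := by
  classical
  have h1 : ∀ α : V, pinv b Δ (flip δ α) = (flipSign δ α : ℝ) • pinv b Δ α := by
    intro α
    unfold flip flipSign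
    split_ifs
    · simp
    · rw [pinv_neg, Units.val_neg, Units.val_one]
      exact (neg_one_smul ℝ _).symm
  rw [frac, frac, Finsupp.prod_mapDomain_index (by simp) (by simp [pow_add]), Finsupp.prod,
    Finsupp.prod]
  simp_rw [h1, smul_pow]
  rw [Finset.prod_smul, smul_smul, ← Finset.prod_mul_distrib]
  have h2 : ∏ α ∈ m.support, (flipSign δ α : ℝ) ^ m α * (flipSign δ α : ℝ) ^ m α = 1 :=
    Finset.prod_eq_one fun α _ => by rw [← mul_pow, flipSign_mul_self, one_pow]
  rw [h2, one_smul]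

theorem support_mapDomain_flip {m : V →₀ ℕ} (hm : LinearIndepOn ℝ id (m.support : Set V)) :
    (m.mapDomain (flip δ)).support = flipSet δ m.support := by
  classical
  rw [Finsupp.mapDomain_support_of_injOn _ (injOn_flip hm), flipSet]

theorem phi_eq_sign_smul (hneg : ∀ α ∈ Δ, -α ∈ Δ) {σ : Finset V} (hσ : σ ∈ bases Δ) :
    phi b Δ σ = sign δ σ • phi b Δ (flipSet δ σ) := by
  classical
  obtain ⟨h1, h2, h3⟩ := mem_bases.mp hσ
  set m : V →₀ ℕ := Finsupp.indicator σ fun _ _ => 1 with hm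
  have hsupp : m.support = σ := by
    ext v
    simp [hm, Finsupp.indicator_apply]
  have hm1 : ∀ α ∈ σ, m α = 1 := fun α hα => Finsupp.indicator_of_mem hα _
  have h4 : m.mapDomain (flip δ) = Finsupp.indicator (flipSet δ σ) fun _ _ => 1 := by
    have h2' : LinearIndepOn ℝ id (m.support : Set V) := by rwa [hsupp]
    have h5 := support_mapDomain_flip (δ := δ) h2'
    rw [hsupp] at h5
    ext v
    by_cases hv : v ∈ flipSet δ σ
    · rw [Finsupp.indicator_of_mem hv]
      obtain ⟨α, hα, rfl⟩ := Finset.mem_image.mp (by simpa [flipSet] using hv)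
      rw [Finsupp.mapDomain_apply' σ m (by rw [hsupp]) (injOn_flip h2) hα, hm1 α hα]
    · rw [Finsupp.indicator_of_notMem hv, ← Finsupp.notMem_support_iff, h5]
      exact hv
  rw [phi_eq_frac h1, phi_eq_frac (mem_bases.mp (flipSet_mem_bases hneg hσ)).1,
    frac_mapDomain_flip (δ := δ) b m, h4, hsupp, sign_eq_prod]
  congr 1
  exact Finset.prod_congr rfl fun α hα => by rw [hm1 α hα, pow_one]

end Flips

/-! ### Cones, walls and chambers. -/

section Cones

variable {V : Type*} [NormedAddCommGroup V] [NormedSpace ℝ V] {Δ : Finset V}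

theorem sum_mem_cone {σ : Finset V} {c : σ → ℝ} (hc : ∀ α, 0 ≤ c α) :
    ∑ α : σ, c α • (α : V) ∈ cone σ := by
  unfold cone
  rw [SetLike.mem_coe]
  refine Submodule.sum_mem _ fun α _ => ?_
  exact Submodule.smul_mem _ (⟨c α, hc α⟩ : {x : ℝ // 0 ≤ x}) (Submodule.subset_span α.2)

theorem mem_cone_iff {σ : Finset V} (hσ : σ ∈ bases Δ) {h : V} :
    h ∈ cone σ ↔ ∀ α, 0 ≤ (basisOf hσ).repr h α := by
  classical
  constructor
  · intro hh
    unfold cone at hh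
    rw [SetLike.mem_coe] at hh
    refine Submodule.span_induction (p := fun h _ => ∀ α, 0 ≤ (basisOf hσ).repr h α)
      ?_ ?_ ?_ ?_ hh
    · intro α hα β
      have : α = basisOf hσ ⟨α, hα⟩ := by rw [basisOf_apply]
      rw [this, Module.Basis.repr_self, Finsupp.single_apply]
      split_ifs <;> norm_num
    · simp
    · intro x y _ _ hx hy α
      rw [map_add, Finsupp.add_apply]
      exact add_nonneg (hx α) (hy α)
    · intro c x _ hx α
      have : (c • x : V) = (c : ℝ) • x := rfl
      rw [this, map_smul, Finsupp.smul_apply]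
      exact mul_nonneg c.2 (hx α)
  · intro hh
    rw [eq_sum_coord hσ h]
    exact sum_mem_cone hh

theorem cone_subset_dualCone {σ : Finset V} {δ : Set (StrongDual ℝ V)}
    (hpos : ∀ α ∈ σ, ∀ y ∈ δ, 0 < y α) : cone σ ⊆ dualCone δ := by
  intro h hh y hy
  unfold cone at hh
  rw [SetLike.mem_coe] at hh
  refine Submodule.span_induction (p := fun h _ => 0 ≤ y h) ?_ ?_ ?_ ?_ hh
  · exact fun α hα => (hpos α hα y hy).le
  · simp
  · intro x z _ _ hx hz
    rw [map_add]
    exact add_nonneg hx hz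
  · intro c x _ hx
    have : (c • x : V) = (c : ℝ) • x := rfl
    rw [this, map_smul]
    exact mul_nonneg c.2 hx

/-- The vectors of σ other than α span a wall, which would contain `h` if its coordinate along α
vanished. -/
theorem coord_ne_zero {σ : Finset V} (hσ : σ ∈ bases Δ) {h : V} (hh : h ∈ reg Δ) (α : σ) :
    (basisOf hσ).repr h α ≠ 0 := by
  classical
  intro h0
  obtain ⟨h1, h2, h3⟩ := mem_bases.mp hσ
  refine hh (Submodule.span ℝ ((σ.erase α : Finset V) : Set V)) ⟨σ.erase α,
    (Finset.erase_subset _ _).trans h1, h2.mono (by simp), ?_, rfl⟩ ?_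
  · rw [Finset.card_erase_of_mem α.2, Module.finrank_eq_card_basis (basisOf hσ), Fintype.card_coe]
    exact Nat.sub_add_cancel (Finset.card_pos.mpr ⟨α, α.2⟩)
  · rw [eq_sum_coord hσ h]
    refine Submodule.sum_mem _ fun β _ => ?_
    by_cases hβ : β = α
    · rw [hβ, h0, zero_smul]
      exact Submodule.zero_mem _
    · refine Submodule.smul_mem _ _ (Submodule.subset_span ?_)
      rw [Finset.mem_coe, Finset.mem_erase]
      exact ⟨fun h => hβ (Subtype.ext h), β.2⟩

/-- The walls form a finite set. -/
theorem exists_finset_walls (Δ : Finset V) : ∃ S : Finset (Submodule ℝ V),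
    (∀ W ∈ S, W ≠ ⊤) ∧ (reg Δ)ᶜ = ⋃ W ∈ S, (W : Set V) := by
  classical
  refine ⟨(Δ.powerset.filter fun κ : Finset V => IsWall Δ (Submodule.span ℝ (κ : Set V))).image
    fun κ : Finset V => Submodule.span ℝ (κ : Set V), ?_, ?_⟩
  · intro W hW
    obtain ⟨κ, hκ, rfl⟩ := Finset.mem_image.mp hW
    obtain ⟨κ', -, -, hcard, heq⟩ := (Finset.mem_filter.mp hκ).2
    rw [heq]
    intro htop
    have h1 := finrank_span_finset_le_card (R := ℝ) κ'
    rw [Set.finrank, htop, finrank_top] at h1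
    omega
  · ext h
    simp only [reg, Set.mem_compl_iff, Set.mem_ofPred_eq, not_forall, Set.mem_iUnion,
      Finset.mem_image, Finset.mem_filter, Finset.mem_powerset, SetLike.mem_coe, exists_prop,
      not_not]
    constructor
    · rintro ⟨W, hW, hh⟩
      obtain ⟨κ, h1, h2, h3, rfl⟩ := id hW
      exact ⟨_, ⟨κ, ⟨h1, hW⟩, rfl⟩, hh⟩
    · rintro ⟨_, ⟨κ, ⟨-, hW⟩, rfl⟩, hh⟩
      exact ⟨_, hW, hh⟩

variable [FiniteDimensional ℝ V]

theorem continuous_coord {σ : Finset V} (hσ : σ ∈ bases Δ) (α : σ) :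
    Continuous fun h : V => (basisOf hσ).repr h α :=
  ((basisOf hσ).coord α).continuous_of_finiteDimensional

/-- Coordinates in σ do not vanish on a chamber, so by connectedness their signs are constant there.
-/
theorem subset_cone_iff {σ : Finset V} (hσ : σ ∈ bases Δ) {γ : Set V} (hγ : IsChamber Δ γ) {h : V}
    (hh : h ∈ γ) : γ ⊆ cone σ ↔ h ∈ cone σ := by
  refine ⟨fun H => H hh, fun H x hx => ?_⟩
  obtain ⟨h', -, rfl⟩ := hγ
  rw [mem_cone_iff hσ] at H ⊢
  intro α
  rcases pos_or_neg_of_isPreconnected isPreconnected_connectedComponentIn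
    (continuous_coord hσ α).continuousOn
    (fun x hx => coord_ne_zero hσ (connectedComponentIn_subset _ _ hx) α) with hp | hn
  · exact (hp x hx).le
  · exact absurd (hn h hh) (not_lt.mpr (H α))

/-- On regular elements the weak inequalities defining the cone are equivalent to the strict ones.
-/
theorem isClopen_cone {σ : Finset V} (hσ : σ ∈ bases Δ) :
    IsClopen {h : reg Δ | (h : V) ∈ cone σ} := by
  have h1 : {h : reg Δ | (h : V) ∈ cone σ} =
      ⋂ α : σ, {h : reg Δ | 0 ≤ (basisOf hσ).repr (h : V) α} := by
    ext h
    simp [mem_cone_iff hσ]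
  have h2 : {h : reg Δ | (h : V) ∈ cone σ} =
      ⋂ α : σ, {h : reg Δ | 0 < (basisOf hσ).repr (h : V) α} := by
    ext h
    simp only [Set.mem_ofPred_eq, mem_cone_iff hσ, Set.mem_iInter]
    exact forall_congr' fun α =>
      ⟨fun H => lt_of_le_of_ne H (coord_ne_zero hσ h.2 α).symm, le_of_lt⟩
  have hc : ∀ α : σ, Continuous fun h : reg Δ => (basisOf hσ).repr (h : V) α := fun α =>
    (continuous_coord hσ α).comp continuous_subtype_val
  constructor
  · rw [h1]
    exact isClosed_iInter fun α => isClosed_le continuous_const (hc α)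
  · rw [h2]
    exact isOpen_iInter_of_finite fun α => isOpen_lt continuous_const (hc α)

theorem continuous_of_mem_locPoly {r : ℕ} {b : Module.Basis (Fin r) ℝ V}
    {δ : Set (StrongDual ℝ V)} {f : reg Δ → ℝ} (hf : f ∈ locPoly b Δ δ) : Continuous f := by
  classical
  refine Submodule.span_induction (p := fun f _ => Continuous f) ?_ continuous_zero
    (fun _ _ _ _ => Continuous.add) (fun c _ _ h => h.const_smul c) hf
  rintro _ ⟨σ, hσ, -, P, rfl⟩
  refine Continuous.if (fun h hh => ?_) ?_ continuous_const
  · rw [(isClopen_cone hσ).frontier_eq] at hh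
    exact absurd hh (Set.notMem_empty _)
  · refine (MvPolynomial.continuous_eval P).comp (continuous_pi fun i => ?_)
    exact (b.coord i).continuous_of_finiteDimensional.comp continuous_subtype_val

theorem isOpen_reg (Δ : Finset V) : IsOpen (reg Δ) := by
  obtain ⟨S, -, hS⟩ := exists_finset_walls Δ
  rw [← isClosed_compl_iff, hS]
  exact S.finite_toSet.isClosed_biUnion fun W _ => W.closed_of_finiteDimensional

theorem measure_compl_reg [MeasurableSpace V] [BorelSpace V] (Δ : Finset V) (μ : Measure V)
    [μ.IsAddHaarMeasure] : μ (reg Δ)ᶜ = 0 := by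
  obtain ⟨S, hS', hS⟩ := exists_finset_walls Δ
  rw [hS]
  exact (measure_biUnion_null_iff S.countable_toSet).mpr fun W hW =>
    Measure.addHaar_submodule μ W (hS' W hW)

end Cones

/-! ### Injectivity of the Laplace transform. -/

section LaplaceUniqueness

open ProbabilityTheory

variable {V : Type*} [NormedAddCommGroup V] [NormedSpace ℝ V] [FiniteDimensional ℝ V]
  [MeasurableSpace V] [BorelSpace V]

/-- Two finite measures whose Laplace transforms exist and agree near the origin are equal. -/
theorem measure_ext_of_laplace {ν₁ ν₂ : Measure V} [IsFiniteMeasure ν₁] [IsFiniteMeasure ν₂]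
    (h : ∀ L : StrongDual ℝ V, ∃ ε > 0, ∀ t ∈ Set.Ioo (-ε) ε,
      Integrable (fun x => Real.exp (t * L x)) ν₁ ∧ Integrable (fun x => Real.exp (t * L x)) ν₂ ∧
      ∫ x, Real.exp (t * L x) ∂ν₁ = ∫ x, Real.exp (t * L x) ∂ν₂) : ν₁ = ν₂ := by
  have : SecondCountableTopology V := inferInstance
  have : CompleteSpace V := FiniteDimensional.complete ℝ V
  refine Measure.ext_of_charFunDual (funext fun L => ?_)
  obtain ⟨ε, hε, hL⟩ := h L
  set S : Set ℂ := {z | z.re ∈ Set.Ioo (-ε) ε} with hS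
  have hint : ∀ ν : Measure V, (∀ t ∈ Set.Ioo (-ε) ε, Integrable (fun x => Real.exp (t * L x)) ν) →
      AnalyticOnNhd ℂ (complexMGF L ν) S := fun ν hν =>
    analyticOnNhd_complexMGF.mono fun z hz =>
      interior_maximal (show Set.Ioo (-ε) ε ⊆ integrableExpSet L ν from hν) isOpen_Ioo hz
  -- Both transforms are analytic on the vertical strip S and agree on a real interval around zero,
  -- so they agree on S; at `Complex.I` they give the characteristic functions.
  have heq : Set.EqOn (complexMGF L ν₁) (complexMGF L ν₂) S := by
    refine (hint ν₁ fun t ht => (hL t ht).1).eqOn_of_preconnected_of_frequently_eq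
      (hint ν₂ fun t ht => (hL t ht).2.1)
      ((convex_Ioo (-ε) ε).linear_preimage Complex.reLm).isPreconnected
      (z₀ := ((0 : ℝ) : ℂ)) (by simpa [hS] using hε) ?_
    have hreal : ∃ᶠ t : ℝ in nhdsWithin 0 {0}ᶜ, complexMGF L ν₁ t = complexMGF L ν₂ t := by
      refine Filter.Eventually.frequently ?_
      refine nhdsWithin_le_nhds ?_
      filter_upwards [Ioo_mem_nhds (neg_lt_zero.mpr hε) hε] with t ht
      rw [complexMGF_ofReal, complexMGF_ofReal]
      exact congrArg _ (hL t ht).2.2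
    refine (Filter.Tendsto.frequently (f := fun t : ℝ => (t : ℂ)) ?_ hreal)
    refine tendsto_nhdsWithin_of_tendsto_nhds_of_eventually_within _
      ((Complex.continuous_ofReal.tendsto 0).mono_left nhdsWithin_le_nhds) ?_
    filter_upwards [self_mem_nhdsWithin] with t ht
    simpa using ht
  have hI := heq (x := Complex.I) (by simpa [hS] using hε)
  rw [charFunDual_apply, charFunDual_apply]
  simpa only [complexMGF, mul_comm Complex.I] using hI

/-- At a base point `y₀` of δ, the positive and negative parts of `exp (-y₀) F` are densities of two
finite measures. Vanishing of the transform near `y₀` says that these measures have the same Laplace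
transform near zero. -/
theorem ae_eq_zero_of_laplace_eq_zero {μ : Measure V} [SigmaFinite μ] {F : V → ℝ}
    {δ : Set (StrongDual ℝ V)} (hδ : IsOpen δ) (hne : δ.Nonempty)
    (hF : ∀ y ∈ δ, Integrable (fun h => Real.exp (-(y h)) * F h) μ ∧
      ∫ h, Real.exp (-(y h)) * F h ∂μ = 0) : F =ᵐ[μ] 0 := by
  obtain ⟨y₀, hy₀⟩ := hne
  set g : V → ℝ := fun h => Real.exp (-(y₀ h)) * F h with hg
  have hgint : Integrable g μ := (hF y₀ hy₀).1
  have hm1 : AEMeasurable (fun h => (g h).toNNReal) μ := hgint.aemeasurable.real_toNNReal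
  have hm2 : AEMeasurable (fun h => (-g h).toNNReal) μ := hgint.neg.aemeasurable.real_toNNReal
  set ν₁ := μ.withDensity fun h => ((g h).toNNReal : ENNReal) with hν₁
  set ν₂ := μ.withDensity fun h => ((-g h).toNNReal : ENNReal) with hν₂
  have : IsFiniteMeasure ν₁ := isFiniteMeasure_withDensity_ofReal hgint.2
  have : IsFiniteMeasure ν₂ := isFiniteMeasure_withDensity_ofReal hgint.neg.2
  have heq : ν₁ = ν₂ := by
    refine measure_ext_of_laplace fun L => ?_
    -- Openness of δ gives room in every direction `L`, as the measure comparison requires.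
    obtain ⟨ε, hε, hball⟩ : ∃ ε : ℝ, 0 < ε ∧ ∀ t ∈ Set.Ioo (-ε) ε, y₀ - t • L ∈ δ := by
      have hc : Continuous fun t : ℝ => y₀ - t • L := by fun_prop
      have h1 : (fun t : ℝ => y₀ - t • L) ⁻¹' δ ∈ nhds (0 : ℝ) :=
        hc.continuousAt.preimage_mem_nhds (hδ.mem_nhds (by simpa using hy₀))
      obtain ⟨ε, hε, h2⟩ := Metric.mem_nhds_iff.mp h1
      rw [Real.ball_eq_Ioo, zero_sub, zero_add] at h2
      exact ⟨ε, hε, fun t ht => h2 ht⟩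
    refine ⟨ε, hε, fun t ht => ?_⟩
    obtain ⟨h1, h2⟩ := hF _ (hball t ht)
    have h3 : (fun h => Real.exp (-((y₀ - t • L) h)) * F h) =
        fun h => Real.exp (t * L h) * g h := by
      funext h
      rw [hg, ← mul_assoc, ← Real.exp_add]
      congr 2
      simp
      ring
    rw [h3] at h1 h2
    have habs : ∀ x : V, Real.exp (t * L x) * g x = Real.exp (t * L x) * max (g x) 0 -
        Real.exp (t * L x) * max (-g x) 0 := fun x => by
      rw [← mul_sub, max_zero_sub_max_neg_zero_eq_self]
    have hp : Integrable (fun x => Real.exp (t * L x) * max (g x) 0) μ := by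
      refine h1.pos_part.congr (Filter.Eventually.of_forall fun x => ?_)
      change max (Real.exp (t * L x) * g x) 0 = Real.exp (t * L x) * max (g x) 0
      rw [mul_max_of_nonneg _ _ (Real.exp_pos _).le, mul_zero]
    have hq : Integrable (fun x => Real.exp (t * L x) * max (-g x) 0) μ := by
      refine h1.neg_part.congr (Filter.Eventually.of_forall fun x => ?_)
      change max (-(Real.exp (t * L x) * g x)) 0 = Real.exp (t * L x) * max (-g x) 0
      rw [mul_max_of_nonneg _ _ (Real.exp_pos _).le, mul_zero, mul_neg]
    have hs1 : (fun x => (g x).toNNReal • Real.exp (t * L x)) =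
        fun x => Real.exp (t * L x) * max (g x) 0 := by
      funext x
      rw [NNReal.smul_def, Real.coe_toNNReal', smul_eq_mul, mul_comm]
    have hs2 : (fun x => (-g x).toNNReal • Real.exp (t * L x)) =
        fun x => Real.exp (t * L x) * max (-g x) 0 := by
      funext x
      rw [NNReal.smul_def, Real.coe_toNNReal', smul_eq_mul, mul_comm]
    refine ⟨?_, ?_, ?_⟩
    · rw [hν₁, integrable_withDensity_iff_integrable_smul₀ hm1, hs1]
      exact hp
    · rw [hν₂, integrable_withDensity_iff_integrable_smul₀ hm2, hs2]
      exact hq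
    · rw [hν₁, hν₂, integral_withDensity_eq_integral_smul₀ hm1,
        integral_withDensity_eq_integral_smul₀ hm2, hs1, hs2, ← sub_eq_zero, ← integral_sub hp hq]
      exact (integral_congr_ae (Filter.Eventually.of_forall fun x => (habs x).symm)).trans h2
  have hae := (withDensity_eq_iff hm1.coe_nnreal_ennreal hm2.coe_nnreal_ennreal
    hgint.lintegral_lt_top.ne).mp heq
  filter_upwards [hae] with x hx
  have h1 : (g x).toNNReal = (-g x).toNNReal := by exact_mod_cast hx
  have h2 : g x = 0 := by
    have h3 := congrArg NNReal.toReal h1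
    rw [Real.coe_toNNReal', Real.coe_toNNReal'] at h3
    have h4 := max_zero_sub_max_neg_zero_eq_self (g x)
    linarith
  exact (mul_eq_zero.mp h2).resolve_left (Real.exp_pos _).ne'

end LaplaceUniqueness

/-! ### The one-dimensional integral. -/

section GammaIntegrals

open scoped Nat

open Classical in
theorem integral_exp_mul_pow {a : ℝ} (ha : 0 < a) (n : ℕ) :
    Integrable (fun x : ℝ => if 0 ≤ x then Real.exp (-(a * x)) * (x ^ n / n !) else 0) ∧
    ∫ x : ℝ, (if 0 ≤ x then Real.exp (-(a * x)) * (x ^ n / n !) else 0) = a⁻¹ ^ (n + 1) := by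
  have h1 : ∫ x : ℝ, (if 0 ≤ x then Real.exp (-(a * x)) * (x ^ n / n !) else 0) =
      a⁻¹ ^ (n + 1) := by
    have h2 : (fun x : ℝ => if 0 ≤ x then Real.exp (-(a * x)) * (x ^ n / n !) else 0) =
        (Set.Ici (0 : ℝ)).indicator fun x => Real.exp (-(a * x)) * (x ^ n / n !) := by
      funext x
      simp [Set.indicator_apply]
    rw [h2, integral_indicator measurableSet_Ici, integral_Ici_eq_integral_Ioi]
    have h3 := Real.integral_rpow_mul_exp_neg_mul_Ioi (a := n + 1) (by positivity) ha
    rw [Real.Gamma_nat_eq_factorial] at h3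
    have h4 : (n : ℝ) + 1 - 1 = n := by ring
    have h5 : ((1 / a : ℝ)) ^ ((n : ℝ) + 1) = a⁻¹ ^ (n + 1) := by
      rw [one_div, ← Real.rpow_natCast]
      push_cast
      rfl
    rw [h4, h5] at h3
    simp_rw [Real.rpow_natCast] at h3
    have h6 : (fun x : ℝ => Real.exp (-(a * x)) * (x ^ n / n !)) =
        fun x => (x ^ n * Real.exp (-(a * x))) * (n ! : ℝ)⁻¹ := by
      funext x
      ring
    rw [h6, integral_mul_const, h3, mul_assoc, mul_inv_cancel₀ (by positivity), mul_one]
  refine ⟨?_, h1⟩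
  -- The integral of a non-integrable function is zero by convention, while the computed value is
  -- positive.
  by_contra hcon
  rw [integral_undef hcon] at h1
  have : (0 : ℝ) < a⁻¹ ^ (n + 1) := by positivity
  linarith

end GammaIntegrals

/-! ### Laplace transforms of monomials on simplicial cones. -/

section ConeIntegrals

open scoped Nat

variable {V : Type*} [NormedAddCommGroup V] [NormedSpace ℝ V] {Δ : Finset V}

open Classical in
/-- The function `∏ x_α ^ n α / (n α)!` on the cone `C(σ)`, extended by zero, where the `x_α` are
the coordinates in the basis `σ`. -/
def coneFun {σ : Finset V} (hσ : σ ∈ bases Δ) (n : V → ℕ) (h : V) : ℝ :=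
  if h ∈ cone σ then ∏ α : σ, (basisOf hσ).repr h α ^ n α / (n α)! else 0

variable [FiniteDimensional ℝ V] [MeasurableSpace V] [BorelSpace V]

/-- By uniqueness of Haar measure, `μ` is the Lebesgue measure of the coordinates times its value on
the unit parallelepiped. -/
theorem integral_comp_coord (μ : Measure V) [μ.IsAddHaarMeasure] {σ : Finset V}
    (hσ : σ ∈ bases Δ) (F : (σ → ℝ) → ℝ) (hF : Integrable F) :
    Integrable (fun h => F ((basisOf hσ).equivFun h)) μ ∧
    ∫ h, F ((basisOf hσ).equivFun h) ∂μ =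
      μ.real (parallelepiped fun α : σ => (α : V)) * ∫ x, F x := by
  classical
  set B := basisOf hσ with hB
  have hmp : MeasurePreserving B.equivFunL B.addHaar volume := by
    refine ⟨B.equivFunL.continuous.measurable, ?_⟩
    have h1 := B.map_addHaar B.equivFunL
    rw [h1]
    have h2 : B.map B.equivFunL.toLinearEquiv = Pi.basisFun ℝ σ := by
      ext i j
      simp [Finsupp.single_apply, Pi.single_apply, eq_comm]
    rw [h2, Module.Basis.addHaar_def, Module.Basis.parallelepiped_basisFun,
      addHaarMeasure_eq_volume_pi]
  have hμ : μ = μ (parallelepiped fun α : σ => (α : V)) • B.addHaar := by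
    have h1 := Measure.addHaarMeasure_unique μ B.parallelepiped
    rw [Module.Basis.coe_parallelepiped] at h1
    have h2 : (B : σ → V) = fun α : σ => (α : V) := funext fun α => basisOf_apply hσ α
    rw [h2] at h1
    rw [Module.Basis.addHaar_def]
    exact h1
  have hemb : MeasurableEmbedding B.equivFunL := B.equivFunL.toHomeomorph.measurableEmbedding
  have hfin : μ (parallelepiped fun α : σ => (α : V)) ≠ ⊤ := by
    have h2 : (B : σ → V) = fun α : σ => (α : V) := funext fun α => basisOf_apply hσ α
    rw [← h2, ← Module.Basis.coe_parallelepiped]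
    exact B.parallelepiped.isCompact.measure_lt_top.ne
  constructor
  · rw [hμ]
    refine Integrable.smul_measure ?_ hfin
    exact (hmp.integrable_comp_emb hemb).mpr hF
  · conv_lhs => rw [hμ]
    rw [integral_smul_measure, smul_eq_mul]
    congr 1
    exact hmp.integral_comp hemb F

/-- In the coordinates of σ both the exponential and the cone function split into factors of one
variable, and Fubini reduces to `integral_exp_mul_pow`. -/
theorem laplace_coneFun (μ : Measure V) [μ.IsAddHaarMeasure] {σ : Finset V} (hσ : σ ∈ bases Δ)
    (n : V → ℕ) {y : StrongDual ℝ V} (hy : ∀ α ∈ σ, 0 < y α) :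
    Integrable (fun h => Real.exp (-(y h)) * coneFun hσ n h) μ ∧
    ∫ h, Real.exp (-(y h)) * coneFun hσ n h ∂μ =
      μ.real (parallelepiped fun α : σ => (α : V)) * ∏ α ∈ σ, (y α)⁻¹ ^ (n α + 1) := by
  classical
  set f : σ → ℝ → ℝ := fun α x =>
    if 0 ≤ x then Real.exp (-(y α * x)) * (x ^ n α / (n α)!) else 0 with hf
  have h1 : (fun h => Real.exp (-(y h)) * coneFun hσ n h) =
      fun h => ∏ α, f α ((basisOf hσ).equivFun h α) := by
    funext h
    simp only [Module.Basis.equivFun_apply, coneFun, hf]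
    by_cases hh : h ∈ cone σ
    · rw [if_pos hh]
      rw [mem_cone_iff hσ] at hh
      rw [Finset.prod_congr rfl fun α _ => if_pos (hh α), Finset.prod_mul_distrib,
        ← Real.exp_sum]
      congr 2
      conv_lhs => rw [eq_sum_coord hσ h]
      rw [map_sum, Finset.sum_neg_distrib]
      congr 1
      exact Finset.sum_congr rfl fun α _ => by rw [map_smul, smul_eq_mul, mul_comm]
    · rw [if_neg hh, mul_zero]
      rw [mem_cone_iff hσ] at hh
      push Not at hh
      obtain ⟨α, hα⟩ := hh
      rw [Finset.prod_eq_zero (Finset.mem_univ α) (if_neg (not_le.mpr hα))]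
  have h2 : Integrable (fun x : σ → ℝ => ∏ α, f α (x α)) :=
    Integrable.fintype_prod fun α => (integral_exp_mul_pow (hy α α.2) (n α)).1
  obtain ⟨h3, h4⟩ := integral_comp_coord μ hσ (fun x : σ → ℝ => ∏ α, f α (x α)) h2
  rw [h1]
  refine ⟨h3, h4.trans ?_⟩
  rw [integral_fintype_prod_volume_eq_prod, ← Finset.prod_coe_sort σ]
  congr 1
  exact Finset.prod_congr rfl fun α _ => (integral_exp_mul_pow (hy α α.2) (n α)).2

end ConeIntegrals

/-! ### Values of fractions, and coordinate monomials as polynomials. -/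

section Evaluation

variable {V : Type*} [NormedAddCommGroup V] [NormedSpace ℝ V] {Δ : Finset V} {r : ℕ}
  {b : Module.Basis (Fin r) ℝ V}

theorem evalAt_algebraMap {y : StrongDual ℝ V} (hy : y ∈ dualReg Δ)
    (p : MvPolynomial (Fin r) ℝ) :
    evalAt b Δ y hy (algebraMap _ (R b Δ) p) = MvPolynomial.aeval (fun i => y (b i)) p := by
  unfold evalAt
  rw [IsLocalization.lift_eq]
  rfl

theorem evalAt_smul {y : StrongDual ℝ V} (hy : y ∈ dualReg Δ) (c : ℝ) (x : R b Δ) :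
    evalAt b Δ y hy (c • x) = c * evalAt b Δ y hy x := by
  rw [← algebraMap_C_mul, map_mul, evalAt_algebraMap, MvPolynomial.aeval_C]
  rfl

theorem evalAt_pinv {y : StrongDual ℝ V} (hy : y ∈ dualReg Δ) {α : V} (hα : α ∈ Δ) :
    evalAt b Δ y hy (pinv b Δ α) = (y α)⁻¹ := by
  have h1 := congrArg (evalAt b Δ y hy) (linR_mul_pinv (b := b) hα)
  rw [map_mul, map_one, linR_apply, evalAt_algebraMap,
    aeval_lin b y (fun v => apply_eq_sum_repr (b := b) y.toLinearMap v)] at h1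
  exact eq_inv_of_mul_eq_one_right h1

theorem evalAt_frac {y : StrongDual ℝ V} (hy : y ∈ dualReg Δ) {m : V →₀ ℕ} (hm : m.support ⊆ Δ) :
    evalAt b Δ y hy (frac b Δ m) = ∏ α ∈ m.support, (y α)⁻¹ ^ m α := by
  rw [frac, Finsupp.prod, map_prod]
  exact Finset.prod_congr rfl fun α hα => by rw [map_pow, evalAt_pinv hy (hm hα)]

end Evaluation

section CoordPoly

open scoped Nat

variable {V : Type*} [AddCommGroup V] [Module ℝ V] {r : ℕ} {b : Module.Basis (Fin r) ℝ V}
  {Δ : Finset V}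

variable (b) in
/-- The polynomial function `∏ x_α ^ n α / (n α)!`, in the coordinates defined by `b`. -/
def coordPoly {σ : Finset V} (hσ : σ ∈ bases Δ) (n : V → ℕ) : MvPolynomial (Fin r) ℝ :=
  ∏ α : σ, MvPolynomial.C ((n α)! : ℝ)⁻¹ *
    (∑ i, MvPolynomial.C ((basisOf hσ).repr (b i) α) * MvPolynomial.X i) ^ n α

theorem eval_coordPoly {σ : Finset V} (hσ : σ ∈ bases Δ) (n : V → ℕ) (h : V) :
    MvPolynomial.eval (fun i => b.repr h i) (coordPoly b hσ n) =
      ∏ α : σ, (basisOf hσ).repr h α ^ n α / (n α)! := by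
  rw [coordPoly, map_prod]
  refine Finset.prod_congr rfl fun α _ => ?_
  have h1 := apply_eq_sum_repr (b := b) ((basisOf hσ).coord α) h
  simp only [Module.Basis.coord_apply] at h1
  rw [map_mul, map_pow, MvPolynomial.eval_C, map_sum, h1, div_eq_inv_mul]
  congr 2
  exact Finset.sum_congr rfl fun i _ => by
    rw [map_mul, MvPolynomial.eval_C, MvPolynomial.eval_X, mul_comm]

end CoordPoly

/-! ### Reduction to bases that are positive on δ. -/

section Chambers

variable {V : Type*} [NormedAddCommGroup V] [NormedSpace ℝ V] {Δ : Finset V} {r : ℕ}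
  {b : Module.Basis (Fin r) ℝ V} {δ : Set (StrongDual ℝ V)}

theorem extend_add (f g : reg Δ → ℝ) : Function.extend Subtype.val (f + g) (0 : V → ℝ) =
    Function.extend Subtype.val f 0 + Function.extend Subtype.val g 0 := by
  rw [← Function.extend_add, add_zero]

theorem extend_smul (c : ℝ) (f : reg Δ → ℝ) : Function.extend Subtype.val (c • f) (0 : V → ℝ) =
    c • Function.extend Subtype.val f 0 := by
  rw [← Function.extend_smul, smul_zero]

theorem coneFun_mem_locPoly {σ : Finset V} (hσ : σ ∈ bases Δ)
    (hpos : ∀ α ∈ σ, ∀ y ∈ δ, 0 < y α) (n : V → ℕ) : (fun h : reg Δ => coneFun hσ n (h : V)) ∈ locPoly b Δ δ := by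
  refine Submodule.subset_span ⟨σ, hσ, cone_subset_dualCone hpos, coordPoly b hσ n, ?_⟩
  funext h
  rw [eval_coordPoly, coneFun]

/-- `G_Δ` is spanned by the fractions with poles along bases that are positive on `δ`. -/
theorem G_induction_pos (hneg : ∀ α ∈ Δ, -α ∈ Δ) (hδ : IsDualChamber Δ δ) {p : R b Δ → Prop}
    (hzero : p 0) (hadd : ∀ x y, p x → p y → p (x + y)) (hsmul : ∀ (c : ℝ) x, p x → p (c • x))
    (hfrac : ∀ (m : V →₀ ℕ), m.support ∈ bases Δ → (∀ α ∈ m.support, ∀ y ∈ δ, 0 < y α) →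
      p (frac b Δ m)) {x : R b Δ} (hx : x ∈ G b Δ) : p x := by
  refine G_induction hzero hadd hsmul (fun m hm => ?_) hx
  have h1 := support_mapDomain_flip (δ := δ) (mem_bases.mp hm).2.1
  rw [frac_mapDomain_flip (δ := δ) b m]
  exact hsmul _ _ (hfrac _ (h1 ▸ flipSet_mem_bases hneg hm) (h1 ▸ flipSet_pos hδ hm))

theorem real_parallelepiped_pos [MeasurableSpace V] [BorelSpace V] {μ : Measure V}
    [μ.IsAddHaarMeasure] {σ : Finset V} (hσ : σ ∈ bases Δ) :
    0 < μ.real (parallelepiped fun α : σ => (α : V)) := by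
  have h2 : (basisOf hσ : σ → V) = fun α : σ => (α : V) := funext fun α => basisOf_apply hσ α
  rw [← h2, ← Module.Basis.coe_parallelepiped]
  refine ENNReal.toReal_pos ?_ (basisOf hσ).parallelepiped.isCompact.measure_lt_top.ne
  exact (Measure.measure_pos_of_nonempty_interior μ
    (basisOf hσ).parallelepiped.interior_nonempty).ne'

end Chambers

/-! ### The Laplace transform for a fixed Haar measure. -/

section Laplace

variable {V : Type*} [NormedAddCommGroup V] [NormedSpace ℝ V] {Δ : Finset V} {r : ℕ}
  {b : Module.Basis (Fin r) ℝ V} [MeasurableSpace V]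

/-- The function `g` is, on `δ`, the Laplace transform of the function `f` for the measure `μ`. -/
def IsLap (μ : Measure V) (δ : Set (StrongDual ℝ V)) (f : reg Δ → ℝ) (g : R b Δ) : Prop :=
  ∀ (y : StrongDual ℝ V) (hy : y ∈ dualReg Δ), y ∈ δ →
    Integrable (fun h => Real.exp (-(y h)) * Function.extend Subtype.val f 0 h) μ ∧
    ∫ h, Real.exp (-(y h)) * Function.extend Subtype.val f 0 h ∂μ = evalAt b Δ y hy g

variable {μ : Measure V} {δ : Set (StrongDual ℝ V)}

theorem IsLap.add {f f' : reg Δ → ℝ} {g g' : R b Δ} (h : IsLap μ δ f g) (h' : IsLap μ δ f' g') :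
    IsLap μ δ (f + f') (g + g') := by
  intro y hy hyδ
  obtain ⟨h1, h2⟩ := h y hy hyδ
  obtain ⟨h3, h4⟩ := h' y hy hyδ
  simp_rw [extend_add, Pi.add_apply, mul_add]
  exact ⟨h1.add h3, by rw [integral_add h1 h3, h2, h4, map_add]⟩

theorem IsLap.smul {f : reg Δ → ℝ} {g : R b Δ} (c : ℝ) (h : IsLap μ δ f g) :
    IsLap μ δ (c • f) (c • g) := by
  intro y hy hyδ
  obtain ⟨h1, h2⟩ := h y hy hyδ
  simp_rw [extend_smul, Pi.smul_apply, smul_eq_mul, mul_left_comm _ c]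
  exact ⟨h1.const_mul c, by rw [integral_const_mul, h2, evalAt_smul]⟩

theorem IsLap.zero : IsLap μ δ (0 : reg Δ → ℝ) (0 : R b Δ) := by
  intro y hy hyδ
  have h1 : Function.extend Subtype.val (0 : reg Δ → ℝ) (0 : V → ℝ) = 0 := Function.extend_zero _
  simp [h1]

theorem IsLap.sum {ι : Type*} (s : Finset ι) {f : ι → reg Δ → ℝ} {g : ι → R b Δ}
    (h : ∀ i ∈ s, IsLap μ δ (f i) (g i)) : IsLap μ δ (∑ i ∈ s, f i) (∑ i ∈ s, g i) := by
  classical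
  induction s using Finset.induction_on with
  | empty => exact IsLap.zero
  | insert i s hi ih =>
    rw [Finset.sum_insert hi, Finset.sum_insert hi]
    exact (h i (Finset.mem_insert_self _ _)).add
      (ih fun j hj => h j (Finset.mem_insert_of_mem hj))

variable [FiniteDimensional ℝ V] [BorelSpace V]

/-- A continuous function on the regular elements is determined by its Laplace transform. -/
theorem eq_zero_of_laplace [μ.IsAddHaarMeasure] (hδ : IsOpen δ) (hne : δ.Nonempty)
    {f : reg Δ → ℝ} (hf : Continuous f)
    (h : ∀ y ∈ δ, Integrable (fun h => Real.exp (-(y h)) * Function.extend Subtype.val f 0 h) μ ∧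
      ∫ h, Real.exp (-(y h)) * Function.extend Subtype.val f 0 h ∂μ = 0) : f = 0 := by
  have hae := ae_eq_zero_of_laplace_eq_zero hδ hne h
  have hext : ∀ x : reg Δ, Function.extend Subtype.val f (0 : V → ℝ) x = f x :=
    fun x => Subtype.val_injective.extend_apply f 0 x
  have hcont : ContinuousOn (Function.extend Subtype.val f (0 : V → ℝ)) (reg Δ) := by
    rw [continuousOn_iff_continuous_domRestrict]
    convert hf using 1
    funext x
    exact hext x
  have h1 := Measure.eqOn_open_of_ae_eq (ae_restrict_of_ae hae) (isOpen_reg Δ) hcont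
    continuousOn_const
  funext x
  rw [← hext x]
  exact h1 x.2

/-- The difference has zero transform on the open set δ, hence vanishes almost everywhere; being
continuous on the open set of regular elements, it vanishes there identically. -/
theorem IsLap.unique [μ.IsAddHaarMeasure] (hδ : IsDualChamber Δ δ) {f f' : reg Δ → ℝ}
    {g : R b Δ} (hf : f ∈ locPoly b Δ δ) (hf' : f' ∈ locPoly b Δ δ) (h : IsLap μ δ f g)
    (h' : IsLap μ δ f' g) : f = f' := by
  have h1 := h.add (h'.smul (-1))
  have h2 : f + (-1 : ℝ) • f' = 0 := by
    refine eq_zero_of_laplace (μ := μ) hδ.isOpen hδ.nonempty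
      (continuous_of_mem_locPoly (Submodule.add_mem _ hf (Submodule.smul_mem _ _ hf')))
      fun y hy => ?_
    obtain ⟨h3, h4⟩ := h1 y (hδ.subset hy) hy
    refine ⟨h3, h4.trans ?_⟩
    rw [map_add, evalAt_smul]
    ring
  rw [neg_one_smul] at h2
  exact eq_of_add_neg_eq_zero h2

/-- Extending by zero only alters the function on the walls, a null set. The exponent `m α - 1` of
the monomial gives back the pole order `m α`. -/
theorem isLap_coneFun [μ.IsAddHaarMeasure] {m : V →₀ ℕ} (hm : m.support ∈ bases Δ)
    (hpos : ∀ α ∈ m.support, ∀ y ∈ δ, 0 < y α) :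
    IsLap μ δ (fun h : reg Δ => coneFun hm (fun α => m α - 1) (h : V))
      (μ.real (parallelepiped fun α : m.support => (α : V)) • frac b Δ m) := by
  intro y hy hyδ
  obtain ⟨h1, h2⟩ := laplace_coneFun μ hm (fun α => m α - 1) fun α hα => hpos α hα y hyδ
  have hae : (fun h => Real.exp (-(y h)) * coneFun hm (fun α => m α - 1) h) =ᵐ[μ]
      fun h => Real.exp (-(y h)) * Function.extend Subtype.val
        (fun h : reg Δ => coneFun hm (fun α => m α - 1) (h : V)) 0 h := by
    have hreg : ∀ᵐ h ∂μ, h ∈ reg Δ := measure_compl_reg Δ μ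
    filter_upwards [hreg] with h hh
    congr 1
    exact (Subtype.val_injective.extend_apply
      (fun h : reg Δ => coneFun hm (fun α => m α - 1) (h : V)) 0 ⟨h, hh⟩).symm
  refine ⟨h1.congr hae, (integral_congr_ae hae).symm.trans (h2.trans ?_)⟩
  rw [evalAt_smul, evalAt_frac hy (mem_bases.mp hm).1]
  congr 1
  refine Finset.prod_congr rfl fun α hα => ?_
  rw [Nat.sub_add_cancel (Nat.one_le_iff_ne_zero.mpr (Finsupp.mem_support_iff.mp hα))]

theorem isLap_frac [μ.IsAddHaarMeasure] {m : V →₀ ℕ} (hm : m.support ∈ bases Δ)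
    (hpos : ∀ α ∈ m.support, ∀ y ∈ δ, 0 < y α) :
    IsLap μ δ ((μ.real (parallelepiped fun α : m.support => (α : V)))⁻¹ •
      fun h : reg Δ => coneFun hm (fun α => m α - 1) (h : V)) (frac b Δ m) := by
  have h1 := (isLap_coneFun (μ := μ) (b := b) hm hpos).smul
    (μ.real (parallelepiped fun α : m.support => (α : V)))⁻¹
  rwa [smul_smul, inv_mul_cancel₀ (real_parallelepiped_pos hm).ne', one_smul] at h1

variable (μ) in
theorem exists_isLap [μ.IsAddHaarMeasure] (hneg : ∀ α ∈ Δ, -α ∈ Δ) (hδ : IsDualChamber Δ δ)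
    {g : R b Δ} (hg : g ∈ G b Δ) : ∃ f ∈ locPoly b Δ δ, IsLap μ δ f g := by
  refine G_induction_pos (p := fun g => ∃ f ∈ locPoly b Δ δ, IsLap μ δ f g) hneg hδ
    ⟨0, Submodule.zero_mem _, IsLap.zero⟩ ?_ ?_ ?_ hg
  · rintro x y ⟨f, hf, h⟩ ⟨f', hf', h'⟩
    exact ⟨_, Submodule.add_mem _ hf hf', h.add h'⟩
  · rintro c x ⟨f, hf, h⟩
    exact ⟨_, Submodule.smul_mem _ c hf, h.smul c⟩
  · intro m hm hpos
    exact ⟨_, Submodule.smul_mem _ _ (coneFun_mem_locPoly hm hpos _), isLap_frac hm hpos⟩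

end Laplace

/-! ### Orientations and forms of maximal degree. -/

section Forms

variable {V : Type*} [NormedAddCommGroup V] [NormedSpace ℝ V] {r : ℕ}

theorem exists_isPos (o : Orientation ℝ V (Fin r)) : ∃ ω, IsPos o ω :=
  ⟨_, o.someVector_ne_zero, o.someVector_ray⟩

theorem pair_smul (dy : ⋀[ℝ]^r V) (t : ℝ) (ω : V [⋀^Fin r]→ₗ[ℝ] ℝ) :
    pair dy (t • ω) = t * pair dy ω := by
  rw [pair, map_smul]
  rfl

theorem isPos_smul_iff {o : Orientation ℝ V (Fin r)} {ω : V [⋀^Fin r]→ₗ[ℝ] ℝ} (hω : IsPos o ω)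
    {t : ℝ} : IsPos o (t • ω) ↔ 0 < t := by
  obtain ⟨hne, rfl⟩ := hω
  constructor
  · rintro ⟨h1, h2⟩
    rw [ray_eq_iff] at h2
    exact (sameRay_smul_left_iff_of_ne hne (left_ne_zero_of_smul h1)).mp h2
  · intro ht
    refine ⟨smul_ne_zero ht.ne' hne, ?_⟩
    rw [ray_eq_iff]
    exact SameRay.sameRay_pos_smul_left _ ht

theorem apply_basis_ne_zero {ω : V [⋀^Fin r]→ₗ[ℝ] ℝ} (hω : ω ≠ 0)
    (b : Module.Basis (Fin r) ℝ V) : ω b ≠ 0 := by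
  intro h
  apply hω
  rw [ω.eq_smul_basis_det b, h, zero_smul]

variable [FiniteDimensional ℝ V] [Fact (Module.finrank ℝ V = r)]

theorem exists_eq_smul {ω : V [⋀^Fin r]→ₗ[ℝ] ℝ} (hω : ω ≠ 0) (dh : V [⋀^Fin r]→ₗ[ℝ] ℝ) :
    ∃ t : ℝ, dh = t • ω := by
  set b := Module.finBasisOfFinrankEq ℝ V (Fact.out : Module.finrank ℝ V = r)
  refine ⟨dh b / ω b, ?_⟩
  rw [ω.eq_smul_basis_det b, smul_smul, ← ω.eq_smul_basis_det b,
    div_mul_cancel₀ _ (apply_basis_ne_zero hω b)]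
  exact dh.eq_smul_basis_det b

variable [MeasurableSpace V] [BorelSpace V]

theorem isAddHaarMeasure_measure {ω : V [⋀^Fin r]→ₗ[ℝ] ℝ} (hω : ω ≠ 0) :
    ω.measure.IsAddHaarMeasure := by
  rw [AlternatingMap.measure]
  exact Measure.IsAddHaarMeasure.nnreal_smul _ (nnnorm_ne_zero_iff.mpr (apply_basis_ne_zero hω _))

theorem measure_smul_form (t : ℝ) (ω : V [⋀^Fin r]→ₗ[ℝ] ℝ) :
    (t • ω).measure = ‖t‖₊ • ω.measure := by
  rw [AlternatingMap.measure, AlternatingMap.measure, AlternatingMap.smul_apply, nnnorm_smul,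
    mul_smul]

/-- The orientation sign and the factor `|t|` of the measure recombine into `t`. For `t = 0` the
sign is `-1`, but the measure is zero. -/
theorem orientedIntegral_smul {o : Orientation ℝ V (Fin r)} {ω : V [⋀^Fin r]→ₗ[ℝ] ℝ}
    (hω : IsPos o ω) (t : ℝ) (F : V → ℝ) :
    orientedIntegral o (t • ω) F = t * ∫ h, F h ∂ω.measure := by
  rw [orientedIntegral, measure_smul_form, integral_smul_nnreal_measure, isPos_smul_iff hω,
    NNReal.smul_def, coe_nnnorm, smul_eq_mul, Real.norm_eq_abs, ← mul_assoc]
  congr 1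
  split_ifs with ht
  · rw [one_mul, abs_of_pos ht]
  · rw [abs_of_nonpos (not_lt.mp ht), neg_one_mul, neg_neg]

theorem vol_eq_abs {σ : Finset V} (e : σ ≃ Fin r) (ω : V [⋀^Fin r]→ₗ[ℝ] ℝ) :
    vol σ ω = |ω fun i => (e.symm i : V)| := by
  have h1 := parallelepiped_comp_equiv (fun α : σ => (α : V)) e.symm
  rw [vol, ← h1, Measure.real, AlternatingMap.measure_parallelepiped,
    ENNReal.toReal_ofReal (abs_nonneg _)]
  rfl

theorem vol_flipSet (b : Module.Basis (Fin r) ℝ V) {Δ : Finset V} (δ : Set (StrongDual ℝ V))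
    {σ : Finset V} (hσ : σ ∈ bases Δ) (ω : V [⋀^Fin r]→ₗ[ℝ] ℝ) :
    vol (flipSet δ σ) ω = vol σ ω := by
  classical
  have hinj := injOn_flip (δ := δ) (mem_bases.mp hσ).2.1
  have e : σ ≃ Fin r := σ.equivFinOfCardEq (card_of_mem_bases b hσ)
  have hb : Set.BijOn (flip δ) (σ : Set V) (flipSet δ σ : Set V) := by
    have h1 : (flipSet δ σ : Set V) = flip δ '' (σ : Set V) := by
      simp [flipSet]
    rw [h1]
    exact hinj.bijOn_image
  have h1 : (fun i => (((hb.equiv (flip δ)).symm.trans e).symm i : V)) =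
      fun i => (flipSign δ (e.symm i : V) : ℝ) • (e.symm i : V) :=
    funext fun i => flip_eq_smul (δ := δ) (e.symm i : V)
  have h2 := vol_eq_abs ((hb.equiv (flip δ)).symm.trans e) ω
  have h3 : vol (flipSet δ σ) ω =
      |ω fun i => (((hb.equiv (flip δ)).symm.trans e).symm i : V)| := h2
  rw [h3, h1, vol_eq_abs e, AlternatingMap.map_smul_univ, smul_eq_mul, abs_mul, Finset.abs_prod]
  simp_rw [abs_flipSign]
  rw [Finset.prod_const_one, one_mul]

variable {b : Module.Basis (Fin r) ℝ V} {Δ : Finset V} {o : Orientation ℝ V (Fin r)}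
  {δ : Set (StrongDual ℝ V)}

/-- Forms of maximal degree are multiples of ω and both sides are linear in the form, so one
positive form suffices. This replaces oriented integrals by integrals against one Haar measure. -/
theorem isLaplace_iff {ω : V [⋀^Fin r]→ₗ[ℝ] ℝ} (hω : IsPos o ω) {f : reg Δ → ℝ} {g : R b Δ}
    {dy : ⋀[ℝ]^r V} :
    IsLaplace b Δ o δ f g dy ↔ IsLap ω.measure δ f (pair dy ω • g) := by
  refine forall₃_congr fun y hy hyδ => ?_
  rw [evalAt_smul]
  constructor
  · intro h
    obtain ⟨h1, h2⟩ := h ω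
    rw [← one_smul ℝ ω, orientedIntegral_smul hω, one_smul, one_mul] at h2
    exact ⟨h1, by rw [h2, mul_comm]⟩
  · rintro ⟨h1, h2⟩ dh
    obtain ⟨t, rfl⟩ := exists_eq_smul hω.choose dh
    rw [measure_smul_form, orientedIntegral_smul hω, h2, pair_smul]
    exact ⟨h1.smul_measure_nnreal, by ring⟩

theorem existsUnique_isLaplace (hneg : ∀ α ∈ Δ, -α ∈ Δ) (hδ : IsDualChamber Δ δ) {g : R b Δ}
    (hg : g ∈ G b Δ) (dy : ⋀[ℝ]^r V) :
    ∃! f, f ∈ locPoly b Δ δ ∧ IsLaplace b Δ o δ f g dy := by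
  obtain ⟨ω, hω⟩ := exists_isPos o
  have := isAddHaarMeasure_measure hω.choose
  simp_rw [isLaplace_iff hω]
  obtain ⟨f, hf, h⟩ := exists_isLap ω.measure hneg hδ (Submodule.smul_mem _ (pair dy ω) hg)
  exact ⟨f, ⟨hf, h⟩, fun f' hf' => IsLap.unique hδ hf'.1 hf hf'.2 h⟩

theorem invLaplace_eq (h0 : (0 : V) ∉ Δ) (hneg : ∀ α ∈ Δ, -α ∈ Δ) (hδ : IsDualChamber Δ δ)
    {ω : V [⋀^Fin r]→ₗ[ℝ] ℝ} (hω : IsPos o ω) {φ : RHat b Δ} {dy : ⋀[ℝ]^r V} {f : reg Δ → ℝ}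
    (hf : f ∈ locPoly b Δ δ) (h : IsLap ω.measure δ f (pair dy ω • princ b Δ φ)) :
    invLaplace b Δ o δ φ dy = f := by
  have hu := existsUnique_isLaplace (o := o) hneg hδ (princ_mem_G h0 φ) dy
  rw [invLaplace, dif_pos hu]
  exact hu.unique hu.choose_spec.1 ⟨hf, (isLaplace_iff hω).mpr h⟩

end Forms

/-! ### The residue as a function on `G_Δ`, with polynomial coefficients in `h`. -/

section ResidueFormula

variable {V : Type*} [AddCommGroup V] [Module ℝ V] {r : ℕ} {b : Module.Basis (Fin r) ℝ V}
  {Δ : Finset V}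

variable (b Δ) in
/-- `Res_Δ (e ^ h x)`, as a function of `x ∈ R_Δ`. -/
def resExp (h0 : (0 : V) ∉ Δ) (h : V) : R b Δ →ₗ[ℝ] R b Δ where
  toFun x := res b Δ (expHat b Δ h * toHat b Δ x)
  map_add' x y := by
    simp only [res_eq_gradedProj h0, map_add, mul_add, taylor_add h0]
  map_smul' c x := by
    simp only [res_eq_gradedProj h0, toHat_smul, mul_smul_comm, taylor_smul h0, map_smul,
      RingHom.id_apply]

theorem resExp_apply (h0 : (0 : V) ∉ Δ) (h : V) (x : R b Δ) :
    resExp b Δ h0 h x = res b Δ (expHat b Δ h * toHat b Δ x) := rfl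

theorem resExp_princ (h0 : (0 : V) ∉ Δ) (h : V) (φ : RHat b Δ) :
    resExp b Δ h0 h (princ b Δ φ) = res b Δ (expHat b Δ h * φ) :=
  (res_exp_mul_eq h0 φ h).symm

theorem resExp_frac (h0 : (0 : V) ∉ Δ) (h : V) {m : V →₀ ℕ} (hm : m.support ∈ bases Δ) :
    resExp b Δ h0 h (frac b Δ m) =
      (∏ α : m.support, (basisOf hm).repr h α ^ (m α - 1) / (m α - 1).factorial) • phi b Δ m.support := by
  classical
  set c : V → ℝ := fun α => if hα : α ∈ m.support then (basisOf hm).repr h ⟨α, hα⟩ else 0 with hc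
  have hc1 : ∀ α : m.support, c α = (basisOf hm).repr h α := fun α => dif_pos α.2
  have h1 : h = ∑ α ∈ m.support, c α • α := by
    rw [← Finset.sum_coe_sort m.support]
    simp_rw [hc1]
    exact eq_sum_coord hm h
  rw [resExp_apply, res_exp_mul_frac h0 hm h1, ← Finset.prod_coe_sort m.support]
  simp_rw [hc1]

theorem phi_mem_G {σ : Finset V} (hσ : σ ∈ bases Δ) : phi b Δ σ ∈ G b Δ := by
  classical
  have h1 := mem_bases.mp hσ
  have h2 : (Finsupp.indicator σ fun _ _ => (1 : ℕ)).support = σ := by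
    ext v
    simp [Finsupp.indicator_apply]
  rw [phi_eq_frac h1.1]
  exact frac_mem_G (by rw [h2]; exact h1.1) (by rw [h2]; exact h1.2.2)

theorem exists_resExp_eq_sum (h0 : (0 : V) ∉ Δ) {x : R b Δ} (hx : x ∈ G b Δ) :
    ∃ c : Finset V → MvPolynomial (Fin r) ℝ, ∀ h : V, resExp b Δ h0 h x =
      ∑ σ ∈ bases Δ, MvPolynomial.eval (fun i => b.repr h i) (c σ) • phi b Δ σ := by
  classical
  refine G_induction (p := fun x => ∃ c : Finset V → MvPolynomial (Fin r) ℝ, ∀ h : V,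
    resExp b Δ h0 h x =
      ∑ σ ∈ bases Δ, MvPolynomial.eval (fun i => b.repr h i) (c σ) • phi b Δ σ) ?_ ?_ ?_ ?_ hx
  · exact ⟨0, fun h => by simp⟩
  · rintro x y ⟨c, hc⟩ ⟨d, hd⟩
    refine ⟨c + d, fun h => ?_⟩
    rw [map_add, hc, hd, ← Finset.sum_add_distrib]
    exact Finset.sum_congr rfl fun σ _ => by rw [Pi.add_apply, map_add, add_smul]
  · rintro a x ⟨c, hc⟩
    refine ⟨fun σ => MvPolynomial.C a * c σ, fun h => ?_⟩
    rw [map_smul, hc, Finset.smul_sum]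
    exact Finset.sum_congr rfl fun σ _ => by rw [map_mul, MvPolynomial.eval_C, mul_smul]
  · intro m hm
    refine ⟨fun σ => if σ = m.support then coordPoly b hm fun α => m α - 1 else 0, fun h => ?_⟩
    rw [Finset.sum_eq_single_of_mem _ hm fun σ _ hσ => by
      simp only [if_neg hσ, map_zero, zero_smul]]
    simp only [if_true, eval_coordPoly, resExp_frac h0 h hm]

theorem resExp_mem_G (h0 : (0 : V) ∉ Δ) (h : V) {x : R b Δ} (hx : x ∈ G b Δ) :
    resExp b Δ h0 h x ∈ G b Δ := by
  obtain ⟨c, hc⟩ := exists_resExp_eq_sum h0 hx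
  rw [hc]
  exact Submodule.sum_mem _ fun σ hσ => Submodule.smul_mem _ _ (phi_mem_G hσ)

end ResidueFormula

/-! ### Comparison of the inverse transforms at `h`. -/

section Inversion

variable {V : Type*} [NormedAddCommGroup V] [NormedSpace ℝ V] [FiniteDimensional ℝ V]
  [MeasurableSpace V] [BorelSpace V] {r : ℕ} {b : Module.Basis (Fin r) ℝ V} {Δ : Finset V}
  {δ : Set (StrongDual ℝ V)} {μ : Measure V} [μ.IsAddHaarMeasure]

theorem isLap_phi {σ : Finset V} (hσ : σ ∈ bases Δ) (hpos : ∀ α ∈ σ, ∀ y ∈ δ, 0 < y α) :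
    IsLap μ δ ((μ.real (parallelepiped fun α : σ => (α : V)))⁻¹ •
      fun h : reg Δ => coneFun hσ 0 (h : V)) (phi b Δ σ) := by
  classical
  obtain ⟨m, rfl, hm1⟩ : ∃ m : V →₀ ℕ, m.support = σ ∧
      m = Finsupp.indicator σ fun _ _ => 1 := by
    refine ⟨_, ?_, rfl⟩
    ext v
    simp [Finsupp.indicator_apply]
  have h1 := isLap_frac (μ := μ) (b := b) hσ hpos
  -- Exponents one on σ and zero elsewhere both become zero under truncated subtraction, so the
  -- monomial is constant.
  have h2 : (fun α => m α - 1) = 0 := by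
    funext α
    rw [hm1, Finsupp.indicator_apply]
    split_ifs <;> rfl
  rw [h2] at h1
  rw [phi_eq_frac (mem_bases.mp hσ).1, ← hm1]
  exact h1

/-- The Jeffrey-Kirwan formula, for elements of `G_Δ`. -/
theorem exists_isLap_resExp (h0 : (0 : V) ∉ Δ) (hneg : ∀ α ∈ Δ, -α ∈ Δ)
    (hδ : IsDualChamber Δ δ) (h : reg Δ) {x : R b Δ} (hx : x ∈ G b Δ) :
    ∃ f ∈ locPoly b Δ δ, ∃ f' ∈ locPoly b Δ δ, IsLap μ δ f x ∧
      IsLap μ δ f' (resExp b Δ h0 (h : V) x) ∧ f h = f' h := by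
  refine G_induction_pos (p := fun x => ∃ f ∈ locPoly b Δ δ, ∃ f' ∈ locPoly b Δ δ, IsLap μ δ f x ∧
      IsLap μ δ f' (resExp b Δ h0 (h : V) x) ∧ f h = f' h) hneg hδ ?_ ?_ ?_ ?_ hx
  · refine ⟨0, Submodule.zero_mem _, 0, Submodule.zero_mem _, IsLap.zero, ?_, rfl⟩
    rw [map_zero]
    exact IsLap.zero
  · rintro x y ⟨f, hf, f', hf', h1, h2, h3⟩ ⟨g, hg, g', hg', h4, h5, h6⟩
    refine ⟨_, Submodule.add_mem _ hf hg, _, Submodule.add_mem _ hf' hg', h1.add h4, ?_, ?_⟩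
    · rw [map_add]
      exact h2.add h5
    · rw [Pi.add_apply, Pi.add_apply, h3, h6]
  · rintro c x ⟨f, hf, f', hf', h1, h2, h3⟩
    refine ⟨_, Submodule.smul_mem _ c hf, _, Submodule.smul_mem _ c hf', h1.smul c, ?_, ?_⟩
    · rw [map_smul]
      exact h2.smul c
    · rw [Pi.smul_apply, Pi.smul_apply, h3]
  · intro m hm hpos
    -- With `h` fixed, the monomial at `h` is a constant multiplying the indicator of the cone; this
    -- second function agrees with the first only at the point `h`.
    have h1 := (isLap_phi (μ := μ) (b := b) hm hpos).smul
      (∏ α : m.support, (basisOf hm).repr (h : V) α ^ (m α - 1) / (m α - 1).factorial)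
    rw [← resExp_frac h0] at h1
    refine ⟨_, Submodule.smul_mem _ _ (coneFun_mem_locPoly hm hpos _), _, Submodule.smul_mem _ _
      (Submodule.smul_mem _ _ (coneFun_mem_locPoly hm hpos _)), isLap_frac hm hpos, h1, ?_⟩
    simp only [Pi.smul_apply, smul_eq_mul, coneFun]
    split_ifs <;> simp [mul_comm]

end Inversion

end

end JeffreyKirwan

/-! ### Assembly of the theorem. -/

open Classical in
theorem mainTheorem8 {V : Type*} [NormedAddCommGroup V] [NormedSpace ℝ V] [FiniteDimensional ℝ V]
    [MeasurableSpace V] [BorelSpace V] {r : ℕ} [Fact (Module.finrank ℝ V = r)]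
    (b : Module.Basis (Fin r) ℝ V) (Δ : Finset V) (h0 : (0 : V) ∉ Δ)
    (hspan : Submodule.span ℝ (Δ : Set V) = ⊤) (hneg : ∀ α ∈ Δ, -α ∈ Δ)
    (o : Orientation ℝ V (Fin r)) (δ : Set (StrongDual ℝ V))
    (hδ : JeffreyKirwan.IsDualChamber Δ δ) :
    -- the projection onto `G_Δ` and the inverse Laplace transform are well defined
    IsCompl (JeffreyKirwan.G b Δ) (JeffreyKirwan.NG b Δ) ∧
    (∀ g ∈ JeffreyKirwan.G b Δ, ∀ dy : ⋀[ℝ]^r V,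
      ∃! f, f ∈ JeffreyKirwan.locPoly b Δ δ ∧ JeffreyKirwan.IsLaplace b Δ o δ f g dy) ∧
    -- the Jeffrey-Kirwan formula
    (∀ (φ : JeffreyKirwan.RHat b Δ) (dy : ⋀[ℝ]^r V) (h : JeffreyKirwan.reg Δ),
      JeffreyKirwan.invLaplace b Δ o δ φ dy h =
        JeffreyKirwan.invLaplace b Δ o δ
          (JeffreyKirwan.toHat b Δ
            (JeffreyKirwan.res b Δ (JeffreyKirwan.expHat b Δ (h : V) * φ))) dy h) ∧
    -- the bases `σ^δ` and the signs `ε(σ, δ)`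
    (∀ σ ∈ JeffreyKirwan.bases Δ,
      JeffreyKirwan.flipSet δ σ ∈ JeffreyKirwan.bases Δ ∧
      JeffreyKirwan.cone (JeffreyKirwan.flipSet δ σ) ⊆ JeffreyKirwan.dualCone δ ∧
      JeffreyKirwan.phi b Δ σ =
        JeffreyKirwan.sign δ σ • JeffreyKirwan.phi b Δ (JeffreyKirwan.flipSet δ σ)) ∧
    -- the residue is a combination of the `φ_σ`, with coefficients polynomial in `h`
    (∀ φ : JeffreyKirwan.RHat b Δ, ∃ c : Finset V → MvPolynomial (Fin r) ℝ, ∀ h : V,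
      JeffreyKirwan.res b Δ (JeffreyKirwan.expHat b Δ h * φ) =
        ∑ σ ∈ JeffreyKirwan.bases Δ,
          MvPolynomial.eval (fun i => b.repr h i) (c σ) • JeffreyKirwan.phi b Δ σ) ∧
    -- the algebraic formula on each chamber `γ`, for any such coefficients
    (∀ (φ : JeffreyKirwan.RHat b Δ) (dy : ⋀[ℝ]^r V) (dh : V [⋀^Fin r]→ₗ[ℝ] ℝ),
      JeffreyKirwan.IsPos o dh → JeffreyKirwan.pair dy dh = 1 →
      ∀ γ : Set V, JeffreyKirwan.IsChamber Δ γ →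
      ∀ h : JeffreyKirwan.reg Δ, (h : V) ∈ γ →
      ∀ c : Finset V → ℝ,
        JeffreyKirwan.res b Δ (JeffreyKirwan.expHat b Δ (h : V) * φ) =
          ∑ σ ∈ JeffreyKirwan.bases Δ, c σ • JeffreyKirwan.phi b Δ σ →
        JeffreyKirwan.invLaplace b Δ o δ φ dy h =
          ∑ σ ∈ (JeffreyKirwan.bases Δ).filter
              (fun σ => γ ⊆ JeffreyKirwan.cone (JeffreyKirwan.flipSet δ σ)),
            JeffreyKirwan.sign δ σ * c σ * (JeffreyKirwan.vol σ dh)⁻¹) := by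

  open JeffreyKirwan in
  refine ⟨isCompl_G_NG h0, fun g hg dy => existsUnique_isLaplace hneg hδ hg dy, ?_,
    fun σ hσ => ⟨flipSet_mem_bases hneg hσ, cone_subset_dualCone (flipSet_pos hδ hσ),
      phi_eq_sign_smul b hneg hσ⟩, fun φ => ?_, ?_⟩
  · intro φ dy h
    obtain ⟨ω, hω⟩ := exists_isPos o
    have := isAddHaarMeasure_measure hω.choose
    obtain ⟨f, hf, f', hf', h1, h2, h3⟩ :=
      exists_isLap_resExp (μ := ω.measure) h0 hneg hδ h (princ_mem_G h0 φ)
    -- The residue lies in `G_Δ`, hence is its own principal part, and `f'` is its inverse transform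
    -- up to the factor `pair dy ω`.
    have h4 := resExp_mem_G h0 (h : V) (princ_mem_G h0 φ)
    rw [resExp_princ] at h2 h4
    rw [invLaplace_eq h0 hneg hδ hω (Submodule.smul_mem _ _ hf) (h1.smul (pair dy ω)),
      invLaplace_eq h0 hneg hδ hω (Submodule.smul_mem _ _ hf')
        (by rw [princ_toHat h0 h4]; exact h2.smul (pair dy ω)),
      Pi.smul_apply, Pi.smul_apply, h3]
  · obtain ⟨c, hc⟩ := exists_resExp_eq_sum h0 (princ_mem_G h0 φ)
    exact ⟨c, fun h => by rw [← hc h, resExp_princ]⟩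
  · intro φ dy ω hω hpair γ hγ h hh c hc
    have := isAddHaarMeasure_measure hω.choose
    obtain ⟨f, hf, f', hf', h1, h2, h3⟩ :=
      exists_isLap_resExp (μ := ω.measure) h0 hneg hδ h (princ_mem_G h0 φ)
    rw [resExp_princ, hc] at h2
    rw [invLaplace_eq h0 hneg hδ hω hf (by rwa [hpair, one_smul]), h3]
    have hflip : ∀ σ : bases Δ, flipSet δ (σ : Finset V) ∈ bases Δ := fun σ =>
      flipSet_mem_bases hneg σ.2
    -- Each `φ_σ` is inverted through its positive version. The `φ_σ` may be linearly dependent, but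
    -- uniqueness of the inverse transform makes the answer independent of the chosen coefficients.
    have h4 := IsLap.sum (Finset.univ : Finset (bases Δ)) fun σ _ =>
      ((isLap_phi (μ := ω.measure) (b := b) (hflip σ) (flipSet_pos hδ σ.2)).smul
        (sign δ (σ : Finset V))).smul (c σ)
    simp_rw [← phi_eq_sign_smul b hneg (Subtype.prop _)] at h4
    rw [Finset.sum_coe_sort (bases Δ) fun σ => c σ • phi b Δ σ] at h4
    rw [IsLap.unique hδ hf' (Submodule.sum_mem _ fun σ _ => Submodule.smul_mem _ _
      (Submodule.smul_mem _ _ (Submodule.smul_mem _ _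
        (coneFun_mem_locPoly (hflip σ) (flipSet_pos hδ σ.2) 0)))) h2 h4,
      Finset.sum_apply, Finset.sum_filter, ← Finset.sum_coe_sort (bases Δ)]
    refine Finset.sum_congr rfl fun σ _ => ?_
    -- Containment of the chamber becomes membership of `h`, which is the condition in `coneFun`;
    -- the volume is unaffected by the signs.
    rw [subset_cone_iff (hflip σ) hγ hh, ← vol_flipSet b δ σ.2 ω]
    simp only [Pi.smul_apply, smul_eq_mul, coneFun, vol]
    split_ifs
    · simp
      ring
    · simp
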